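/- Let $K$ be an infinite field, and let $\mathrm{GL}(3,K)$ act on the right on the space $K^3$ of row vectors. For an $n$-dimensional $K$-vector space $V$ and $k\ge 0$, let $Sh^n_k(V)$ be the abelian group generated by the symbols $[v_1,\dots,v_{n+k}]$ with $v_1,\dots,v_{n+k}\in V$ nonzero, subject to the relations: the symbol is alternating (permuting the arguments by $\sigma$ multiplies it by $\operatorname{sgn}(\sigma)$, and it is $0$ if two arguments are equal); it does not change if an argument is multiplied by a nonzero element of $K$; and it is $0$ if $v_1,\dots,v_{n+k}$ do not span $V$. The boundary map $Sh^n_{k+1}(V)\to Sh^n_k(V)$ is $$[v_0,\dots,v_{n+k}]\mapsto\sum_{i=0}^{n+k}(-1)^i[v_0,\dots,\widehat{v_i},\dots,v_{n+k}].$$ The Steinberg module $St_n(V)$ is the cokernel of $Sh^n_1(V)\to Sh^n_0(V)$, and $\{v_1,\dots,v_n\}$ denotes the class of $[v_1,\dots,v_n]$ in it. For $k\ge0$ write $Sh_k=Sh^3_k(K^3)$. Define right $\mathbb Z[\mathrm{GL}(3,K)]$-modules $$X_0=\mathbb Z[\mathbb P(K^3)],\qquad X_1=\bigoplus_{H} St_2(H),\qquad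 X_i=Sh_{i-2}\quad(i\ge 2),$$ where $X_0$ is the free abelian group on the points of the projective plane $\mathbb P(K^3)$, $H$ runs over the two-dimensional subspaces of $K^3$, and $g\in \mathrm{GL}(3,K)$ acts by $(a)\mapsto(ag)$, by $\{a,b\}\in St_2(H)\mapsto\{ag,bg\}\in St_2(Hg)$, and by $[v_1,\dots,v_m]\mapsto[v_1g,\dots,v_mg]$, respectively. The maps are as follows: $X_{i+1}\to X_i$ for $i\ge2$ is the boundary map of the sharbly complex; $X_2\to X_1$ sends $[a,b,c]$, for $a,b,c$ spanning $K^3$, to $\{a,b\}+\{b,c\}+\{c,a\}$, where each term lies in the summand of the plane spanned by its two vectors; $X_1\to X_0$ sends $\{a,b\}$ to $(b)-(a)$; and $\varepsilon\colon X_0\to\mathbb Z$ sends every point to $1$, where $\mathrm{GL}(3,K)$ acts trivially on $\mathbb Z$. Then these maps are well-defined homomorphisms of $\mathbb Z[\mathrm{GL}(3,K)]$-modules, and the sequence $$\cdots\to X_i\to X_{i-1}\to\cdots\to X_2\to X_1\to X_0\xrightarrow{\ \varepsilon\ }\mathbb Z\to 0$$ is exact. -/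

import Mathlib

noncomputable section

namespace Spliced

open scoped LinearAlgebra.Projectivization DirectSum

universe u

section General

variable (K : Type u) [Field K] (V : Type u) [AddCommGroup V] [Module K V]
  {W : Type u} [AddCommGroup W] [Module K W] {U : Type u} [AddCommGroup U] [Module K U]

/-- The nonzero vectors of `V`. -/
abbrev NonzeroVec (V : Type u) [AddCommGroup V] : Type u := {v : V // v ≠ 0}

/-- The relations between the symbols `[v₁, …, vₘ]` (`vᵢ ∈ V` nonzero): the symbol is alternating
in its arguments, it does not change if arguments are multiplied by nonzero scalars, and it
vanishes if the arguments do not span `V`. -/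
def relations (m : ℕ) : AddSubgroup ((Fin m → NonzeroVec V) →₀ ℤ) :=
  AddSubgroup.closure
    ({x | ∃ (v : Fin m → NonzeroVec V) (σ : Equiv.Perm (Fin m)),
        x = Finsupp.single (v ∘ σ) 1 - Finsupp.single v (Equiv.Perm.sign σ : ℤ)} ∪
     {x | ∃ v : Fin m → NonzeroVec V, ¬ Function.Injective v ∧ x = Finsupp.single v 1} ∪
     {x | ∃ v w : Fin m → NonzeroVec V, (∀ i, ∃ a : Kˣ, (w i : V) = (a : K) • (v i : V)) ∧
        x = Finsupp.single w 1 - Finsupp.single v 1} ∪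
     {x | ∃ v : Fin m → NonzeroVec V,
        Submodule.span K (Set.range fun i => (v i : V)) ≠ ⊤ ∧ x = Finsupp.single v 1})

/-- The abelian group generated by the symbols `[v₁, …, vₘ]` with `m` arguments in `V`, subject
to `relations`. If `dim V = n`, then `Symbols K V (n + k)` is the group `Shⁿₖ(V)` of
`k`-sharblies. -/
def Symbols (m : ℕ) : Type u := ((Fin m → NonzeroVec V) →₀ ℤ) ⧸ relations K V m

instance (m : ℕ) : AddCommGroup (Symbols K V m) :=
  inferInstanceAs (AddCommGroup (((Fin m → NonzeroVec V) →₀ ℤ) ⧸ relations K V m))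

/-- The group `Shₖ(V)` of `k`-sharblies of an `n`-dimensional space `V`. -/
abbrev Sh (n k : ℕ) : Type u := Symbols K V (n + k)

/-- The quotient map from the free abelian group. -/
def mkSymbols (m : ℕ) : ((Fin m → NonzeroVec V) →₀ ℤ) →+ Symbols K V m :=
  QuotientAddGroup.mk' (relations K V m)

variable {V} in
/-- The basic sharbly `[v₁, …, vₘ]`. -/
def symbol {m : ℕ} (v : Fin m → NonzeroVec V) : Symbols K V m :=
  mkSymbols K V m (Finsupp.single v 1)

variable {K V}

theorem mkSymbols_eq_zero {m : ℕ} {x : (Fin m → NonzeroVec V) →₀ ℤ} (h : x ∈ relations K V m) :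
    mkSymbols K V m x = 0 :=
  (QuotientAddGroup.eq_zero_iff x).2 h

theorem symbol_perm {m : ℕ} (v : Fin m → NonzeroVec V) (σ : Equiv.Perm (Fin m)) :
    symbol K (v ∘ σ) = (Equiv.Perm.sign σ : ℤ) • symbol K v := by
  unfold symbol
  rw [← map_zsmul, ← sub_eq_zero, ← map_sub, Finsupp.smul_single, smul_eq_mul, mul_one]
  exact mkSymbols_eq_zero (AddSubgroup.subset_closure (Or.inl (Or.inl (Or.inl ⟨v, σ, rfl⟩))))

theorem symbol_not_injective {m : ℕ} (v : Fin m → NonzeroVec V) (h : ¬ Function.Injective v) :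
    symbol K v = 0 :=
  mkSymbols_eq_zero (AddSubgroup.subset_closure (Or.inl (Or.inl (Or.inr ⟨v, h, rfl⟩))))

theorem symbol_scale {m : ℕ} (v w : Fin m → NonzeroVec V)
    (h : ∀ i, ∃ a : Kˣ, (w i : V) = (a : K) • (v i : V)) : symbol K w = symbol K v := by
  unfold symbol
  rw [← sub_eq_zero, ← map_sub]
  exact mkSymbols_eq_zero (AddSubgroup.subset_closure (Or.inl (Or.inr ⟨v, w, h, rfl⟩)))

theorem symbol_not_span {m : ℕ} (v : Fin m → NonzeroVec V)
    (h : Submodule.span K (Set.range fun i => (v i : V)) ≠ ⊤) : symbol K v = 0 :=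
  mkSymbols_eq_zero (AddSubgroup.subset_closure (Or.inr ⟨v, h, rfl⟩))

/-- A function on symbols which respects the relations defines a homomorphism. -/
def liftSymbols {A : Type u} [AddCommGroup A] {m : ℕ}
    (φ : (Fin m → NonzeroVec V) → A)
    (h₁ : ∀ v (σ : Equiv.Perm (Fin m)), φ (v ∘ σ) = (Equiv.Perm.sign σ : ℤ) • φ v)
    (h₂ : ∀ v, ¬ Function.Injective v → φ v = 0)
    (h₃ : ∀ v w, (∀ i, ∃ a : Kˣ, (w i : V) = (a : K) • (v i : V)) → φ w = φ v)
    (h₄ : ∀ v, Submodule.span K (Set.range fun i => (v i : V)) ≠ ⊤ → φ v = 0) :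
    Symbols K V m →+ A :=
  QuotientAddGroup.lift (relations K V m)
    (Finsupp.liftAddHom fun v => zmultiplesHom A (φ v)) (by
      unfold relations
      rw [AddSubgroup.closure_le]
      rintro x (((⟨v, σ, rfl⟩ | ⟨v, h, rfl⟩) | ⟨v, w, h, rfl⟩) | ⟨v, h, rfl⟩)
      · rw [SetLike.mem_coe, AddMonoidHom.mem_ker, map_sub]
        simp [h₁]
      · simp [h₂ v h]
      · rw [SetLike.mem_coe, AddMonoidHom.mem_ker, map_sub]
        simp [h₃ v w h]
      · simp [h₄ v h])

theorem liftSymbols_symbol {A : Type u} [AddCommGroup A] {m : ℕ}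
    (φ : (Fin m → NonzeroVec V) → A) (h₁) (h₂) (h₃) (h₄) (v : Fin m → NonzeroVec V) :
    liftSymbols (K := K) φ h₁ h₂ h₃ h₄ (symbol K v) = φ v := by
  change Finsupp.liftAddHom (fun v => zmultiplesHom A (φ v)) (Finsupp.single v 1) = φ v
  simp

theorem symbols_hom_ext {A : Type u} [AddCommGroup A] {m : ℕ}
    {f g : Symbols K V m →+ A} (h : ∀ v, f (symbol K v) = g (symbol K v)) : f = g := by
  apply QuotientAddGroup.addMonoidHom_ext
  apply Finsupp.addHom_ext'
  intro v
  apply AddMonoidHom.ext_int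
  exact h v

theorem face_aux {m : ℕ} (v : Fin (m + 1) → NonzeroVec V) (π ρ : Equiv.Perm (Fin (m + 1)))
    (h : π 0 = ρ 0) :
    (Equiv.Perm.sign π : ℤ) • symbol K (v ∘ π ∘ Fin.succ) =
      (Equiv.Perm.sign ρ : ℤ) • symbol K (v ∘ ρ ∘ Fin.succ) := by
  obtain ⟨⟨p, τ⟩, hτ⟩ := Equiv.Perm.decomposeFin.symm.surjective (ρ⁻¹ * π)
  have hp : p = 0 := by
    have := congrArg (fun e : Equiv.Perm (Fin (m + 1)) => e 0) hτ
    simpa [h] using this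
  subst hp
  have hπ : π = ρ * Equiv.Perm.decomposeFin.symm (0, τ) := by rw [hτ]; group
  have hs : v ∘ π ∘ Fin.succ = (v ∘ ρ ∘ Fin.succ) ∘ τ := by
    funext j
    simp [hπ]
  rw [hs, symbol_perm, hπ, smul_smul]
  congr 1
  rw [Equiv.Perm.sign_mul, Equiv.Perm.decomposeFin.symm_sign]
  rcases Int.units_eq_one_or (Equiv.Perm.sign τ) with h | h <;> simp [h]

theorem face_eq {m : ℕ} (v : Fin (m + 1) → NonzeroVec V) (i : Fin (m + 1)) :
    ((-1 : ℤ) ^ (i : ℕ)) • symbol K (v ∘ i.succAbove) =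
      (Equiv.Perm.sign i.cycleRange⁻¹ : ℤ) • symbol K (v ∘ (i.cycleRange⁻¹ : Equiv.Perm _) ∘ Fin.succ) := by
  rw [Equiv.Perm.sign_inv, Fin.sign_cycleRange]
  have : (i.cycleRange⁻¹ : Equiv.Perm (Fin (m + 1))) ∘ Fin.succ = i.succAbove := by
    funext j
    simp only [Function.comp_apply]
    rw [Equiv.Perm.inv_eq_iff_eq, Fin.cycleRange_succAbove]
  rw [this]
  simp

theorem cycleRange_inv_zero {m : ℕ} (i : Fin (m + 1)) : (i.cycleRange⁻¹ : Equiv.Perm _) 0 = i := by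
  rw [Equiv.Perm.inv_eq_iff_eq, Fin.cycleRange_self]

variable (K V) in
/-- The boundary map `[v₀, …, vₘ] ↦ ∑ᵢ (-1)ⁱ [v₀, …, v̂ᵢ, …, vₘ]` of the sharbly complex. -/
def boundary (m : ℕ) : Symbols K V (m + 1) →+ Symbols K V m :=
  liftSymbols (fun v => ∑ i : Fin (m + 1), ((-1 : ℤ) ^ (i : ℕ)) • symbol K (v ∘ i.succAbove))
    (by
      intro v σ
      rw [Finset.smul_sum, ← Equiv.sum_comp σ (fun i => (Equiv.Perm.sign σ : ℤ) •
        ((-1 : ℤ) ^ (i : ℕ)) • symbol K (v ∘ i.succAbove))]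
      refine Finset.sum_congr rfl fun i _ => ?_
      rw [face_eq, face_eq, ← face_aux v (σ * i.cycleRange⁻¹) ((σ i).cycleRange⁻¹)
        (by rw [Equiv.Perm.mul_apply, cycleRange_inv_zero, cycleRange_inv_zero]), smul_smul,
        Equiv.Perm.sign_mul]
      have hc : (v ∘ σ) ∘ (i.cycleRange⁻¹ : Equiv.Perm _) ∘ Fin.succ =
        v ∘ (σ * i.cycleRange⁻¹ : Equiv.Perm _) ∘ Fin.succ := rfl
      rw [hc]
      congr 1
      rcases Int.units_eq_one_or (Equiv.Perm.sign σ) with h | h <;> simp [h])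
    (by
      intro v hv
      rw [Function.not_injective_iff] at hv
      obtain ⟨p, q, hpq, hne⟩ := hv
      rw [Finset.sum_eq_add p q hne]
      · rw [face_eq, face_eq, ← face_aux v (Equiv.swap p q * p.cycleRange⁻¹) (q.cycleRange⁻¹)
          (by rw [Equiv.Perm.mul_apply, cycleRange_inv_zero, cycleRange_inv_zero]; simp),
          Equiv.Perm.sign_mul, Equiv.Perm.sign_swap hne]
        have hc : v ∘ (Equiv.swap p q * p.cycleRange⁻¹ : Equiv.Perm _) ∘ Fin.succ =
            v ∘ (p.cycleRange⁻¹ : Equiv.Perm _) ∘ Fin.succ := by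
          have hs : v ∘ Equiv.swap p q = v := by
            funext j
            simp only [Function.comp_apply]
            rw [Equiv.swap_apply_def]
            split_ifs with h1 h2
            · rw [h1, hpq]
            · rw [h2, hpq]
            · rfl
          calc v ∘ (Equiv.swap p q * p.cycleRange⁻¹ : Equiv.Perm _) ∘ Fin.succ
              = (v ∘ Equiv.swap p q) ∘ (p.cycleRange⁻¹ : Equiv.Perm _) ∘ Fin.succ := rfl
            _ = _ := by rw [hs]
        rw [hc]
        simp
      · intro i _ hi
        rw [symbol_not_injective, smul_zero]
        obtain ⟨p', hp'⟩ := Fin.exists_succAbove_eq hi.1.symm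
        obtain ⟨q', hq'⟩ := Fin.exists_succAbove_eq hi.2.symm
        intro hinj
        apply hne
        rw [← hp', ← hq']
        congr 1
        apply hinj
        simp [hp', hq', hpq]
      · simp
      · simp)
    (by
      intro v w h
      refine Finset.sum_congr rfl fun i _ => ?_
      rw [symbol_scale (v ∘ i.succAbove) (w ∘ i.succAbove) (fun j => h _)])
    (by
      intro v h
      refine Finset.sum_eq_zero fun i _ => ?_
      rw [symbol_not_span, smul_zero]
      intro hi
      apply h
      rw [eq_top_iff, ← hi]
      apply Submodule.span_mono
      rintro _ ⟨j, rfl⟩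
      exact ⟨_, rfl⟩)

theorem boundary_symbol {m : ℕ} (v : Fin (m + 1) → NonzeroVec V) :
    boundary K V m (symbol K v) =
      ∑ i : Fin (m + 1), ((-1 : ℤ) ^ (i : ℕ)) • symbol K (v ∘ i.succAbove) :=
  liftSymbols_symbol _ _ _ _ _ v

/-- The image of a nonzero vector under a linear isomorphism. -/
def mapVec (e : V ≃ₗ[K] W) (v : NonzeroVec V) : NonzeroVec W :=
  ⟨e v.1, fun h => v.2 (e.map_eq_zero_iff.1 h)⟩

theorem mapVec_injective (e : V ≃ₗ[K] W) : Function.Injective (mapVec e) := by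
  intro a b h
  exact Subtype.ext (e.injective (congrArg Subtype.val h))

theorem span_mapVec {ι : Type*} (e : V ≃ₗ[K] W) (v : ι → NonzeroVec V) :
    Submodule.span K (Set.range fun i => ((mapVec e (v i) : NonzeroVec W) : W)) =
      (Submodule.span K (Set.range fun i => (v i : V))).map e.toLinearMap := by
  rw [Submodule.map_span, ← Set.range_comp]
  rfl

theorem span_mapVec_eq_top {ι : Type*} (e : V ≃ₗ[K] W) (v : ι → NonzeroVec V) :
    Submodule.span K (Set.range fun i => ((mapVec e (v i) : NonzeroVec W) : W)) = ⊤ ↔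
      Submodule.span K (Set.range fun i => (v i : V)) = ⊤ := by
  rw [span_mapVec]
  constructor
  · intro h
    apply Submodule.map_injective_of_injective e.injective
    rw [h, Submodule.map_top, LinearMap.range_eq_top.2 e.surjective]
  · intro h
    rw [h, Submodule.map_top, LinearMap.range_eq_top.2 e.surjective]

/-- `[v₁, …, vₘ] ↦ [e v₁, …, e vₘ]`, for a linear isomorphism `e : V ≃ W`. -/
def mapSymbols (e : V ≃ₗ[K] W) (m : ℕ) : Symbols K V m →+ Symbols K W m :=
  liftSymbols (fun v => symbol K (mapVec e ∘ v))
    (fun v σ => symbol_perm (mapVec e ∘ v) σ)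
    (fun v h => symbol_not_injective _ fun h' => h h'.of_comp)
    (fun v w h => symbol_scale _ _ fun i => by
      obtain ⟨a, ha⟩ := h i
      exact ⟨a, by simp [mapVec, ha]⟩)
    (fun v h => symbol_not_span _ fun h' => h ((span_mapVec_eq_top e v).1 h'))

theorem mapSymbols_symbol (e : V ≃ₗ[K] W) {m : ℕ} (v : Fin m → NonzeroVec V) :
    mapSymbols e m (symbol K v) = symbol K (mapVec e ∘ v) :=
  liftSymbols_symbol _ _ _ _ _ v

theorem boundary_mapSymbols (e : V ≃ₗ[K] W) (m : ℕ) :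
    (boundary K W m).comp (mapSymbols e (m + 1)) = (mapSymbols e m).comp (boundary K V m) := by
  apply symbols_hom_ext
  intro v
  simp only [AddMonoidHom.comp_apply, mapSymbols_symbol, boundary_symbol, map_sum, map_zsmul]
  rfl

variable (K V) in
/-- The Steinberg module `Stₙ(V)` of an `n`-dimensional space `V`: the cokernel of
`Sh₁(V) → Sh₀(V)`. -/
def Steinberg (n : ℕ) : Type u := Sh K V n 0 ⧸ (boundary K V n).range

instance (n : ℕ) : AddCommGroup (Steinberg K V n) :=
  inferInstanceAs (AddCommGroup (Sh K V n 0 ⧸ (boundary K V n).range))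

variable (K V) in
/-- The quotient map `Sh₀(V) → Stₙ(V)`. -/
def mkSteinberg (n : ℕ) : Sh K V n 0 →+ Steinberg K V n :=
  QuotientAddGroup.mk' (boundary K V n).range

variable (K) in
/-- The element `{v₁, …, vₙ}` of the Steinberg module: the class of `[v₁, …, vₙ]`. -/
def stSymbol {n : ℕ} (v : Fin n → NonzeroVec V) : Steinberg K V n :=
  mkSteinberg K V n (symbol K v)

/-- A homomorphism on `Sh₀(V)` which vanishes on boundaries defines one on `Stₙ(V)`. -/
def liftSteinberg {A : Type u} [AddCommGroup A] {n : ℕ} (f : Symbols K V n →+ A)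
    (h : f.comp (boundary K V n) = 0) : Steinberg K V n →+ A :=
  QuotientAddGroup.lift (boundary K V n).range f (by
    rintro _ ⟨x, rfl⟩
    exact DFunLike.congr_fun h x)

theorem liftSteinberg_stSymbol {A : Type u} [AddCommGroup A] {n : ℕ} (f : Symbols K V n →+ A)
    (h : f.comp (boundary K V n) = 0) (v : Fin n → NonzeroVec V) :
    liftSteinberg f h (stSymbol K v) = f (symbol K v) := rfl

theorem steinberg_hom_ext {A : Type u} [AddCommGroup A] {n : ℕ}
    {f g : Steinberg K V n →+ A} (h : ∀ v, f (stSymbol K v) = g (stSymbol K v)) : f = g := by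
  apply QuotientAddGroup.addMonoidHom_ext
  exact symbols_hom_ext h

/-- `{v₁, …, vₙ} ↦ {e v₁, …, e vₙ}`, for a linear isomorphism `e : V ≃ W`. -/
def mapSteinberg (e : V ≃ₗ[K] W) (n : ℕ) : Steinberg K V n →+ Steinberg K W n :=
  liftSteinberg ((mkSteinberg K W n).comp (mapSymbols e n)) (by
    rw [AddMonoidHom.comp_assoc, ← boundary_mapSymbols]
    ext x
    exact (QuotientAddGroup.eq_zero_iff _).2 ⟨mapSymbols e (n + 1) x, rfl⟩)

theorem mapSteinberg_stSymbol (e : V ≃ₗ[K] W) {n : ℕ} (v : Fin n → NonzeroVec V) :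
    mapSteinberg e n (stSymbol K v) = stSymbol K (mapVec e ∘ v) := by
  unfold mapSteinberg
  rw [liftSteinberg_stSymbol, AddMonoidHom.comp_apply, mapSymbols_symbol]
  rfl

variable (K V) in
/-- The set of planes (two-dimensional subspaces) of `V`. -/
abbrev Plane : Type u := {H : Submodule K V // Module.finrank K H = 2}

variable (K V) in
/-- The group `⨁_H St₂(H)`, where `H` runs over the planes of `V`. -/
def PlaneSteinberg : Type u := ⨁ H : Plane K V, Steinberg K H.1 2

instance : AddCommGroup (PlaneSteinberg K V) :=
  inferInstanceAs (AddCommGroup (⨁ H : Plane K V, Steinberg K H.1 2))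

open Classical in
/-- The inclusion of the summand `St₂(H)`. -/
def ofPlane (H : Plane K V) : Steinberg K H.1 2 →+ PlaneSteinberg K V :=
  DirectSum.of (fun H : Plane K V => Steinberg K H.1 2) H

open Classical in
/-- A family of maps on the summands defines a map on the direct sum. -/
def liftPlanes {A : Type u} [AddCommGroup A]
    (f : ∀ H : Plane K V, Steinberg K H.1 2 →+ A) : PlaneSteinberg K V →+ A :=
  DirectSum.toAddMonoid f

theorem liftPlanes_ofPlane {A : Type u} [AddCommGroup A]
    (f : ∀ H : Plane K V, Steinberg K H.1 2 →+ A) (H : Plane K V) (x : Steinberg K H.1 2) :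
    liftPlanes f (ofPlane H x) = f H x := by
  classical
  exact DirectSum.toAddMonoid_of f H x

theorem planes_hom_ext {A : Type u} [AddCommGroup A]
    {f g : PlaneSteinberg K V →+ A}
    (h : ∀ H v, f (ofPlane H (stSymbol K v)) = g (ofPlane H (stSymbol K v))) : f = g := by
  classical
  apply DirectSum.addHom_ext'
  intro H
  exact steinberg_hom_ext (h H)

theorem ofPlane_congr {H H' : Plane K V} (v : Fin 2 → NonzeroVec H.1)
    (v' : Fin 2 → NonzeroVec H'.1) (h : H.1 = H'.1)
    (hv : ∀ i, ((v i : H.1) : V) = ((v' i : H'.1) : V)) :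
    ofPlane H (stSymbol K v) = ofPlane H' (stSymbol K v') := by
  obtain ⟨H, hH⟩ := H
  obtain ⟨H', hH'⟩ := H'
  cases h
  have : v = v' := by
    funext i
    exact Subtype.ext (Subtype.ext (hv i))
  rw [this]

/-- The image of a plane under a linear isomorphism. -/
def mapPlane (e : V ≃ₗ[K] W) (H : Plane K V) : Plane K W :=
  ⟨H.1.map e.toLinearMap, by rw [← (e.submoduleMap H.1).finrank_eq]; exact H.2⟩

/-- The isomorphism from a plane to its image. -/
def planeEquiv (e : V ≃ₗ[K] W) (H : Plane K V) : H.1 ≃ₗ[K] (mapPlane e H).1 :=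
  e.submoduleMap H.1

/-- The map `⨁_H St₂(H) → ⨁_{H'} St₂(H')` induced by a linear isomorphism `e`: it sends
`{a, b} ∈ St₂(H)` to `{e a, e b} ∈ St₂(e H)`. -/
def mapPlaneSteinberg (e : V ≃ₗ[K] W) : PlaneSteinberg K V →+ PlaneSteinberg K W :=
  liftPlanes fun H => (ofPlane (mapPlane e H)).comp (mapSteinberg (planeEquiv e H) 2)

theorem mapPlaneSteinberg_apply (e : V ≃ₗ[K] W) (H : Plane K V) (v : Fin 2 → NonzeroVec H.1) :
    mapPlaneSteinberg e (ofPlane H (stSymbol K v)) =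
      ofPlane (mapPlane e H) (stSymbol K (mapVec (planeEquiv e H) ∘ v)) := by
  unfold mapPlaneSteinberg
  rw [liftPlanes_ofPlane, AddMonoidHom.comp_apply, mapSteinberg_stSymbol]

/-! ### The boundary map `⨁_H St₂(H) → ℤ[ℙ(V)]` -/

variable (K V) in
/-- The free abelian group `ℤ[ℙ(V)]` on the points of the projective space `ℙ(V)`. -/
def Points : Type u := ℙ K V →₀ ℤ

instance : AddCommGroup (Points K V) := inferInstanceAs (AddCommGroup (ℙ K V →₀ ℤ))

/-- The point of the projective space `ℙ(V)` defined by a nonzero vector, as a basis element. -/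
def point (K : Type u) [Field K] {V : Type u} [AddCommGroup V] [Module K V] (a : NonzeroVec V) :
    Points K V :=
  Finsupp.single (Projectivization.mk K a.1 a.2) 1

theorem point_scale (a b : NonzeroVec V) (h : ∃ c : Kˣ, (b : V) = (c : K) • (a : V)) :
    point K b = point K a := by
  obtain ⟨c, hc⟩ := h
  unfold point
  congr 1
  rw [Projectivization.mk_eq_mk_iff]
  exact ⟨c, hc.symm⟩

/-- A nonzero vector of a subspace as a nonzero vector of the ambient space. -/
def inclVec {H : Submodule K V} (a : NonzeroVec H) : NonzeroVec V :=
  ⟨a.1.1, fun h => a.2 (Subtype.ext h)⟩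

/-- The restriction of `{a, b} ↦ (b) - (a)` to the sharblies `Sh₀(H)`. -/
def planeBoundarySh (H : Plane K V) : Symbols K H.1 2 →+ Points K V :=
  liftSymbols (fun v => point K (inclVec (v 1)) - point K (inclVec (v 0)))
    (by
      intro v σ
      have hσ : σ = 1 ∨ σ = Equiv.swap 0 1 := by
        revert σ
        decide
      rcases hσ with rfl | rfl
      · simp
      · simp)
    (by
      intro v hv
      have : v 0 = v 1 := by
        by_contra hne
        apply hv
        intro i j hij
        fin_cases i <;> fin_cases j <;> simp_all
      rw [this, sub_self])
    (by
      intro v w h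
      have hp : ∀ i, point K (inclVec (w i)) = point K (inclVec (v i)) := by
        intro i
        obtain ⟨c, hc⟩ := h i
        exact point_scale _ _ ⟨c, by simp [inclVec, hc]⟩
      rw [hp, hp])
    (by
      intro v h
      rw [sub_eq_zero]
      have hli : ¬ LinearIndependent K (fun i => (v i : H.1)) := by
        intro hli
        have hf : FiniteDimensional K H.1 := Module.finite_of_finrank_pos (by rw [H.2]; decide)
        exact h (hli.span_eq_top_of_card_eq_finrank' (by rw [H.2]; simp))
      have hp : ∃ c : K, c • (v 0 : H.1) = (v 1 : H.1) := by
        by_contra hne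
        push Not at hne
        apply hli
        have h2 : (fun i => (v i : H.1)) = ![(v 0 : H.1), (v 1 : H.1)] := by
          funext i
          fin_cases i <;> rfl
        rw [h2, LinearIndependent.pair_iff' (v 0).2]
        exact hne
      obtain ⟨c, hc⟩ := hp
      have hc0 : c ≠ 0 := by
        rintro rfl
        exact (v 1).2 (by rw [← hc, zero_smul])
      refine point_scale _ _ ⟨Units.mk0 c hc0, ?_⟩
      simp [inclVec, ← hc])

theorem planeBoundarySh_symbol (H : Plane K V) (v : Fin 2 → NonzeroVec H.1) :
    planeBoundarySh H (symbol K v) = point K (inclVec (v 1)) - point K (inclVec (v 0)) :=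
  liftSymbols_symbol _ _ _ _ _ v

variable (K V) in
/-- The boundary map `∂₁ : {a, b} ↦ (b) - (a)` on `⨁_H St₂(H)`. -/
def planeBoundary : PlaneSteinberg K V →+ Points K V :=
  liftPlanes fun H => liftSteinberg (planeBoundarySh H) (by
    apply symbols_hom_ext
    intro v
    rw [AddMonoidHom.comp_apply, boundary_symbol]
    rw [map_sum]
    simp only [map_zsmul, planeBoundarySh_symbol]
    refine (Fin.sum_univ_three _).trans ?_
    simp [Fin.succAbove])

theorem planeBoundary_apply (H : Plane K V) (v : Fin 2 → NonzeroVec H.1) :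
    planeBoundary K V (ofPlane H (stSymbol K v)) =
      point K (inclVec (v 1)) - point K (inclVec (v 0)) := by
  unfold planeBoundary
  rw [liftPlanes_ofPlane, liftSteinberg_stSymbol, planeBoundarySh_symbol]

/-- The map on `ℤ[ℙ(V)]` induced by a linear isomorphism. -/
def mapPoints (e : V ≃ₗ[K] W) : Points K V →+ Points K W :=
  Finsupp.mapDomain.addMonoidHom (Projectivization.map e.toLinearMap e.injective)

theorem mapPoints_point (e : V ≃ₗ[K] W) (a : NonzeroVec V) :
    mapPoints e (point K a) = point K (mapVec e a) := by
  unfold point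
  change Finsupp.mapDomain _ (Finsupp.single _ _) = _
  rw [Finsupp.mapDomain_single, Projectivization.map_mk]
  rfl

theorem points_hom_ext {A : Type*} [AddCommGroup A]
    {f g : Points K V →+ A} (h : ∀ a, f (point K a) = g (point K a)) : f = g := by
  apply Finsupp.addHom_ext'
  intro p
  apply AddMonoidHom.ext_int
  induction p with
  | h v hv => exact h ⟨v, hv⟩

variable (K V) in
/-- The augmentation `ℤ[ℙ(V)] → ℤ`, which sends each point to `1`. -/
def augmentation : Points K V →+ ℤ :=
  Finsupp.liftAddHom fun _ => AddMonoidHom.id ℤ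

theorem augmentation_point (a : NonzeroVec V) : augmentation K V (point K a) = 1 := by
  change Finsupp.liftAddHom (fun _ => AddMonoidHom.id ℤ) (Finsupp.single _ 1) = (1 : ℤ)
  simp

theorem augmentation_map (e : V ≃ₗ[K] W) :
    (augmentation K W).comp (mapPoints e) = augmentation K V :=
  points_hom_ext fun a => by
    rw [AddMonoidHom.comp_apply, mapPoints_point, augmentation_point, augmentation_point]

theorem planeBoundary_map (e : V ≃ₗ[K] W) :
    (planeBoundary K W).comp (mapPlaneSteinberg e) = (mapPoints e).comp (planeBoundary K V) := by
  apply planes_hom_ext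
  intro H v
  simp only [AddMonoidHom.comp_apply, mapPlaneSteinberg_apply, planeBoundary_apply, map_sub,
    mapPoints_point]
  rfl

/-! ### The boundary map `Sh₀(V) → ⨁_H St₂(H)` -/

open Classical in
/-- The element `{a, b}` of `St₂(H) ⊆ ⨁_H St₂(H)`, where `H` is the plane spanned by `a` and `b`
(and zero if `a` and `b` are proportional). -/
def edge (K : Type u) [Field K] {V : Type u} [AddCommGroup V] [Module K V] (a b : NonzeroVec V) :
    PlaneSteinberg K V :=
  if h : Module.finrank K (Submodule.span K ({a.1, b.1} : Set V)) = 2 then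
    ofPlane ⟨Submodule.span K ({a.1, b.1} : Set V), h⟩
      (stSymbol K ![⟨⟨a.1, Submodule.subset_span (by simp)⟩, fun h => a.2 (congrArg Subtype.val h)⟩,
        ⟨⟨b.1, Submodule.subset_span (by simp)⟩, fun h => b.2 (congrArg Subtype.val h)⟩])
  else 0

theorem edge_eq (H : Plane K V) (v : Fin 2 → NonzeroVec H.1)
    (h : H.1 = Submodule.span K ({((v 0 : H.1) : V), ((v 1 : H.1) : V)} : Set V)) :
    edge K (inclVec (v 0)) (inclVec (v 1)) = ofPlane H (stSymbol K v) := by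
  have h2 := H.2
  rw [h] at h2
  unfold edge
  change Module.finrank K (Submodule.span K ({(inclVec (v 0)).1, (inclVec (v 1)).1} : Set V)) = 2 at h2
  rw [dif_pos h2]
  apply ofPlane_congr
  · exact h.symm
  · intro i
    fin_cases i <;> rfl

theorem edge_of_finrank_ne (a b : NonzeroVec V)
    (h : Module.finrank K (Submodule.span K ({a.1, b.1} : Set V)) ≠ 2) : edge K a b = 0 :=
  dif_neg h

theorem edge_swap (a b : NonzeroVec V) : edge K b a = - edge K a b := by
  by_cases h : Module.finrank K (Submodule.span K ({a.1, b.1} : Set V)) = 2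
  · let H : Plane K V := ⟨_, h⟩
    let v : Fin 2 → NonzeroVec H.1 :=
      ![⟨⟨a.1, Submodule.subset_span (by simp)⟩, fun h => a.2 (congrArg Subtype.val h)⟩,
        ⟨⟨b.1, Submodule.subset_span (by simp)⟩, fun h => b.2 (congrArg Subtype.val h)⟩]
    have h1 : edge K a b = ofPlane H (stSymbol K v) := edge_eq H v rfl
    have h2 : edge K b a = ofPlane H (stSymbol K (v ∘ Equiv.swap 0 1)) :=
      edge_eq H (v ∘ Equiv.swap 0 1) (by
        change Submodule.span K ({a.1, b.1} : Set V) = Submodule.span K ({b.1, a.1} : Set V)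
        rw [Set.pair_comm])
    rw [h1, h2, ← map_neg]
    congr 1
    unfold stSymbol
    rw [symbol_perm, ← map_neg]
    congr 1
    rw [Equiv.Perm.sign_swap (by decide)]
    simp
  · rw [edge_of_finrank_ne a b h, edge_of_finrank_ne b a (by rwa [Set.pair_comm]), neg_zero]

theorem edge_self (a : NonzeroVec V) : edge K a a = 0 := by
  apply edge_of_finrank_ne
  rw [Set.pair_eq_singleton, finrank_span_singleton a.2]
  decide

theorem edge_scale (a b a' b' : NonzeroVec V) (ha : ∃ c : Kˣ, (a' : V) = (c : K) • (a : V))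
    (hb : ∃ c : Kˣ, (b' : V) = (c : K) • (b : V)) : edge K a' b' = edge K a b := by
  have hs : Submodule.span K ({a'.1, b'.1} : Set V) = Submodule.span K ({a.1, b.1} : Set V) := by
    obtain ⟨c, hc⟩ := ha
    obtain ⟨d, hd⟩ := hb
    rw [Submodule.span_insert, Submodule.span_insert, hc, hd,
      Submodule.span_singleton_smul_eq c.isUnit, Submodule.span_singleton_smul_eq d.isUnit]
  by_cases h : Module.finrank K (Submodule.span K ({a.1, b.1} : Set V)) = 2
  · let H : Plane K V := ⟨_, h⟩
    let v : Fin 2 → NonzeroVec H.1 :=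
      ![⟨⟨a.1, Submodule.subset_span (by simp)⟩, fun h => a.2 (congrArg Subtype.val h)⟩,
        ⟨⟨b.1, Submodule.subset_span (by simp)⟩, fun h => b.2 (congrArg Subtype.val h)⟩]
    let w : Fin 2 → NonzeroVec H.1 :=
      ![⟨⟨a'.1, (hs ▸ Submodule.subset_span (by simp) : a'.1 ∈ Submodule.span K ({a.1, b.1} : Set V))⟩,
          fun h => a'.2 (congrArg Subtype.val h)⟩,
        ⟨⟨b'.1, (hs ▸ Submodule.subset_span (by simp) : b'.1 ∈ Submodule.span K ({a.1, b.1} : Set V))⟩,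
          fun h => b'.2 (congrArg Subtype.val h)⟩]
    have h1 : edge K a b = ofPlane H (stSymbol K v) := edge_eq H v rfl
    have h2 : edge K a' b' = ofPlane H (stSymbol K w) := edge_eq H w hs.symm
    rw [h1, h2]
    congr 1
    unfold stSymbol
    congr 1
    apply symbol_scale
    intro i
    fin_cases i
    · obtain ⟨c, hc⟩ := ha
      exact ⟨c, Subtype.ext hc⟩
    · obtain ⟨c, hc⟩ := hb
      exact ⟨c, Subtype.ext hc⟩
  · rw [edge_of_finrank_ne a b h, edge_of_finrank_ne a' b' (by rwa [hs])]

theorem edge_map (e : V ≃ₗ[K] W) (a b : NonzeroVec V) :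
    mapPlaneSteinberg e (edge K a b) = edge K (mapVec e a) (mapVec e b) := by
  have hs : Submodule.span K ({(mapVec e a).1, (mapVec e b).1} : Set W) =
      (Submodule.span K ({a.1, b.1} : Set V)).map e.toLinearMap := by
    rw [Submodule.map_span, Set.image_pair]
    rfl
  by_cases h : Module.finrank K (Submodule.span K ({a.1, b.1} : Set V)) = 2
  · let H : Plane K V := ⟨_, h⟩
    let v : Fin 2 → NonzeroVec H.1 :=
      ![⟨⟨a.1, Submodule.subset_span (by simp)⟩, fun h => a.2 (congrArg Subtype.val h)⟩,
        ⟨⟨b.1, Submodule.subset_span (by simp)⟩, fun h => b.2 (congrArg Subtype.val h)⟩]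
    have h1 : edge K a b = ofPlane H (stSymbol K v) := edge_eq H v rfl
    rw [h1, mapPlaneSteinberg_apply]
    exact (edge_eq (mapPlane e H) (mapVec (planeEquiv e H) ∘ v) hs.symm).symm
  · rw [edge_of_finrank_ne a b h, map_zero, edge_of_finrank_ne]
    rwa [hs, ← (e.submoduleMap _).finrank_eq]

open Classical in
/-- The value of `∂₂` on the symbol `[a, b, c]`: it is `{a, b} + {b, c} + {c, a}` if `a, b, c`
span `V`; otherwise `[a, b, c] = 0`. -/
def triangle (K : Type u) [Field K] {V : Type u} [AddCommGroup V] [Module K V]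
    (v : Fin 3 → NonzeroVec V) : PlaneSteinberg K V :=
  if Submodule.span K (Set.range fun i => (v i : V)) = ⊤ then
    edge K (v 0) (v 1) + edge K (v 1) (v 2) + edge K (v 2) (v 0)
  else 0

variable (K V) in
/-- The boundary map `∂₂ : [a, b, c] ↦ {a, b} + {b, c} + {c, a}`, for `a, b, c` spanning `V`. -/
def triangleBoundary : Symbols K V 3 →+ PlaneSteinberg K V :=
  liftSymbols (triangle K)
    (by
      intro v σ
      have hr : (Set.range fun i => ((v ∘ σ) i : V)) = Set.range fun i => (v i : V) :=
        σ.surjective.range_comp (fun i => ((v i : NonzeroVec V) : V))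
      unfold triangle
      rw [hr]
      split_ifs with h
      · have e01 := edge_swap (K := K) (v 0) (v 1)
        have e12 := edge_swap (K := K) (v 1) (v 2)
        have e20 := edge_swap (K := K) (v 2) (v 0)
        have key : ∀ σ : Equiv.Perm (Fin 3),
            (Equiv.Perm.sign σ = 1 ∧
              ((σ 0 = 0 ∧ σ 1 = 1 ∧ σ 2 = 2) ∨ (σ 0 = 1 ∧ σ 1 = 2 ∧ σ 2 = 0) ∨
                (σ 0 = 2 ∧ σ 1 = 0 ∧ σ 2 = 1))) ∨
            (Equiv.Perm.sign σ = -1 ∧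
              ((σ 0 = 0 ∧ σ 1 = 2 ∧ σ 2 = 1) ∨ (σ 0 = 1 ∧ σ 1 = 0 ∧ σ 2 = 2) ∨
                (σ 0 = 2 ∧ σ 1 = 1 ∧ σ 2 = 0))) := by decide
        simp only [Function.comp_apply]
        rcases key σ with ⟨hs, ⟨h0, h1, h2⟩ | ⟨h0, h1, h2⟩ | ⟨h0, h1, h2⟩⟩ |
            ⟨hs, ⟨h0, h1, h2⟩ | ⟨h0, h1, h2⟩ | ⟨h0, h1, h2⟩⟩ <;>
          rw [hs, h0, h1, h2] <;> simp [e01, e12, e20] <;> abel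
      · simp)
    (by
      intro v hv
      unfold triangle
      split_ifs with h
      · have hv' : v 0 = v 1 ∨ v 1 = v 2 ∨ v 2 = v 0 := by
          by_contra hne
          push Not at hne
          obtain ⟨h1, h2, h3⟩ := hne
          apply hv
          intro i j hij
          fin_cases i <;> fin_cases j <;> simp_all
        rcases hv' with h1 | h1 | h1
        · rw [h1, edge_self, edge_swap (v 1) (v 2)]; abel
        · rw [h1, edge_self, edge_swap (v 2) (v 0)]; abel
        · rw [h1, edge_self, edge_swap (v 0) (v 1)]; abel
      · rfl)
    (by
      intro v w h
      have hr : Submodule.span K (Set.range fun i => (w i : V)) =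
          Submodule.span K (Set.range fun i => (v i : V)) := by
        rw [Submodule.span_range_eq_iSup, Submodule.span_range_eq_iSup]
        refine iSup_congr fun i => ?_
        obtain ⟨c, hc⟩ := h i
        rw [hc, Submodule.span_singleton_smul_eq c.isUnit]
      unfold triangle
      rw [hr, edge_scale _ _ _ _ (h 0) (h 1), edge_scale _ _ _ _ (h 1) (h 2),
        edge_scale _ _ _ _ (h 2) (h 0)])
    (by
      intro v h
      exact if_neg h)

theorem triangleBoundary_symbol (v : Fin 3 → NonzeroVec V) :
    triangleBoundary K V (symbol K v) = triangle K v :=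
  liftSymbols_symbol _ _ _ _ _ v

theorem triangleBoundary_map (e : V ≃ₗ[K] W) :
    (triangleBoundary K W).comp (mapSymbols e 3) =
      (mapPlaneSteinberg e).comp (triangleBoundary K V) := by
  apply symbols_hom_ext
  intro v
  simp only [AddMonoidHom.comp_apply, mapSymbols_symbol, triangleBoundary_symbol, triangle]
  have := span_mapVec_eq_top e v
  simp only [Function.comp_apply]
  split_ifs with h1 h2 h2
  · simp [edge_map]
  · exact absurd (this.1 h1) h2
  · exact absurd (this.2 h2) h1
  · simp

/-! ### Functoriality -/

theorem mapSymbols_refl (m : ℕ) : mapSymbols (LinearEquiv.refl K V) m = AddMonoidHom.id _ :=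
  symbols_hom_ext fun v => by rw [mapSymbols_symbol]; rfl

theorem mapSymbols_trans (e : V ≃ₗ[K] W) (f : W ≃ₗ[K] U) (m : ℕ) :
    mapSymbols (e.trans f) m = (mapSymbols f m).comp (mapSymbols e m) :=
  symbols_hom_ext fun v => by
    rw [AddMonoidHom.comp_apply, mapSymbols_symbol, mapSymbols_symbol, mapSymbols_symbol]; rfl

theorem mapPlaneSteinberg_refl : mapPlaneSteinberg (LinearEquiv.refl K V) = AddMonoidHom.id _ :=
  planes_hom_ext fun H v => by
    rw [mapPlaneSteinberg_apply]
    exact ofPlane_congr _ _ (Submodule.map_id _) fun i => rfl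

theorem mapPlaneSteinberg_trans (e : V ≃ₗ[K] W) (f : W ≃ₗ[K] U) :
    mapPlaneSteinberg (e.trans f) = (mapPlaneSteinberg f).comp (mapPlaneSteinberg e) :=
  planes_hom_ext fun H v => by
    rw [AddMonoidHom.comp_apply, mapPlaneSteinberg_apply, mapPlaneSteinberg_apply,
      mapPlaneSteinberg_apply]
    exact ofPlane_congr _ _ (Submodule.map_comp e.toLinearMap f.toLinearMap H.1) fun i => rfl

theorem mapPoints_refl : mapPoints (LinearEquiv.refl K V) = AddMonoidHom.id _ :=
  points_hom_ext fun a => by rw [mapPoints_point]; rfl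

theorem mapPoints_trans (e : V ≃ₗ[K] W) (f : W ≃ₗ[K] U) :
    mapPoints (e.trans f) = (mapPoints f).comp (mapPoints e) :=
  points_hom_ext fun a => by
    rw [AddMonoidHom.comp_apply, mapPoints_point, mapPoints_point, mapPoints_point]; rfl

end General

/-! ### The spliced complex of `GL(3, K)`-modules -/

variable (K : Type u) [Field K]

/-- The space `K³` of row vectors. -/
abbrev Row : Type u := Fin 3 → K

/-- The group opposite to `GL(3, K)`. A right action of `GL(3, K)` is the same thing as a (left)
action of this group. -/
abbrev GLop : Type u := (Matrix.GeneralLinearGroup (Fin 3) K)ᵐᵒᵖ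

variable {K}

/-- The right action `v ↦ v g` of `g ∈ GL(3, K)` on row vectors. -/
def rowEquiv (g : GLop K) : Row K ≃ₗ[K] Row K :=
  Matrix.toLinearEquivRight'OfInv
    (M := (g.unop⁻¹ : Matrix.GeneralLinearGroup (Fin 3) K).val) (M' := g.unop.val)
    (by rw [← Units.val_mul, inv_mul_cancel, Units.val_one])
    (by rw [← Units.val_mul, mul_inv_cancel, Units.val_one])

theorem rowEquiv_apply (g : GLop K) (v : Row K) :
    rowEquiv g v = Matrix.vecMul v g.unop.val := rfl

theorem rowEquiv_one : rowEquiv (1 : GLop K) = LinearEquiv.refl K (Row K) := by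
  ext v
  simp [rowEquiv_apply]

theorem rowEquiv_mul (g h : GLop K) : rowEquiv (g * h) = (rowEquiv h).trans (rowEquiv g) := by
  ext1 v
  simp [rowEquiv_apply, Matrix.vecMul_vecMul]

variable (K)

/-- The right action of `GL(3, K)` on sharblies: `[v₁, …, vₘ] g = [v₁ g, …, vₘ g]`. -/
def shRep (m : ℕ) : Representation ℤ (GLop K) (Symbols K (Row K) m) where
  toFun g := (mapSymbols (rowEquiv g) m).toIntLinearMap
  map_one' := by rw [rowEquiv_one, mapSymbols_refl]; rfl
  map_mul' g h := by rw [rowEquiv_mul, mapSymbols_trans]; rfl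

/-- The right action of `GL(3, K)` on `⨁_H St₂(H)`: `{a, b} g = {a g, b g}`. -/
def planeRep : Representation ℤ (GLop K) (PlaneSteinberg K (Row K)) where
  toFun g := (mapPlaneSteinberg (rowEquiv g)).toIntLinearMap
  map_one' := by rw [rowEquiv_one, mapPlaneSteinberg_refl]; rfl
  map_mul' g h := by rw [rowEquiv_mul, mapPlaneSteinberg_trans]; rfl

/-- The right action of `GL(3, K)` on the free abelian group on the points of `ℙ(K³)`. -/
def pointRep : Representation ℤ (GLop K) (Points K (Row K)) where
  toFun g := (mapPoints (rowEquiv g)).toIntLinearMap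
  map_one' := by rw [rowEquiv_one, mapPoints_refl]; rfl
  map_mul' g h := by rw [rowEquiv_mul, mapPoints_trans]; rfl

/-- The terms of the spliced complex: `X₀ = ℤ[ℙ(K³)]`, the `0`-chains of the complex of points in
general position (every point is a vertex), `X₁ = ⨁_H St₂(H)`, and `X_{k+2} = Shₖ(K³)`. -/
def X : ℕ → Rep.{u} ℤ (GLop K)
  | 0 => Rep.of (pointRep K)
  | 1 => Rep.of (planeRep K)
  | k + 2 => Rep.of (X := Sh K (Row K) 3 k) (shRep K (3 + k))

/-- The boundary maps `d i = ∂_{i+1} : X_{i+1} → X_i` of the spliced complex. -/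
def d : ∀ i : ℕ, X K (i + 1) ⟶ X K i
  | 0 => Rep.ofHom
      (LinearMap.intertwiningMap_of_isIntertwiningMap (ρ := planeRep K) (σ := pointRep K)
        (planeBoundary K (Row K)).toIntLinearMap
        fun g => DFunLike.congr_fun (planeBoundary_map (rowEquiv g)))
  | 1 => Rep.ofHom
      (LinearMap.intertwiningMap_of_isIntertwiningMap (ρ := shRep K 3) (σ := planeRep K)
        (triangleBoundary K (Row K)).toIntLinearMap
        fun g => DFunLike.congr_fun (triangleBoundary_map (rowEquiv g)))
  | k + 2 => Rep.ofHom
      (LinearMap.intertwiningMap_of_isIntertwiningMap (ρ := shRep K (3 + k + 1))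
        (σ := shRep K (3 + k))
        (boundary K (Row K) (3 + k)).toIntLinearMap
        fun g => DFunLike.congr_fun (boundary_mapSymbols (rowEquiv g) (3 + k)))

/-- The augmentation `ε : X₀ → ℤ`, which sends each point to `1`; `GL(3, K)` acts trivially
on `ℤ`. -/
def ε : (pointRep K).IntertwiningMap (Representation.trivial ℤ (GLop K) ℤ) :=
  LinearMap.intertwiningMap_of_isIntertwiningMap (pointRep K)
    (Representation.trivial ℤ (GLop K) ℤ)
    (augmentation K (Row K)).toIntLinearMap
    fun g => DFunLike.congr_fun (augmentation_map (rowEquiv g))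

end Spliced

end

noncomputable section

namespace Spliced

universe u

/-! ### Alternating chains on a set of points -/

section AltChains

/-! Let `C` be the augmented complex of alternating chains on the points of `ℙ(V)`, `dim V = 3`,
graded by the number of vertices, and let `N` be the part generated by simplices that do not span
`V`. A cone with fixed apex contracts `C` (`altBoundary_cone_const`), and the sharblies with `m`
vertices are `C_m / N_m` (`altToSymbols_surjective`, `mem_nonspanning_of_altToSymbols`). So
exactness of the sharbly complex reduces to filling cycles of `N` inside `N`.

With at least three vertices this is possible: distinct points that do not span `V` span a plane,
and so do those of each facet. A cone whose apex is chosen once for each plane therefore contracts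
`N` in this range without leaving it (`pointSpan_face`, `altBoundary_spanCone`).

At `X₂` this is replaced by a description of `X₁`. Two distinct points lie on exactly one plane `H`,
and `St₂(H)` consists of edges in `H` modulo boundaries of triangles in `H`, which are non-spanning.
Hence `[p, q] ↦ {p, q}` identifies `X₁` with `C₂ / ∂N₃`, of which
`exists_nonspanning_of_altToPlanes` is the injectivity.

At `X₁` and `X₀`, joining everything to a fixed point `o` by edges `{o, p}` and triangles `[o, a,
b]` gives explicit preimages. -/

/-- The relations between the simplices `[p₁, …, pₘ]` on a set `P` of points which make them
alternating. -/
def altRelations (P : Type u) (m : ℕ) : AddSubgroup ((Fin m → P) →₀ ℤ) :=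
  AddSubgroup.closure
    ({x | ∃ (p : Fin m → P) (σ : Equiv.Perm (Fin m)),
        x = Finsupp.single (p ∘ σ) 1 - Finsupp.single p (Equiv.Perm.sign σ : ℤ)} ∪
     {x | ∃ p : Fin m → P, ¬ Function.Injective p ∧ x = Finsupp.single p 1})

/-- The alternating chains on a set `P`, generated by the simplices with `m` vertices. -/
def AltChains (P : Type u) (m : ℕ) : Type u := ((Fin m → P) →₀ ℤ) ⧸ altRelations P m

instance (P : Type u) (m : ℕ) : AddCommGroup (AltChains P m) :=
  inferInstanceAs (AddCommGroup (((Fin m → P) →₀ ℤ) ⧸ altRelations P m))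

variable {P : Type u}

variable (P) in
/-- The quotient map from the free abelian group. -/
def mkAlt (m : ℕ) : ((Fin m → P) →₀ ℤ) →+ AltChains P m :=
  QuotientAddGroup.mk' (altRelations P m)

/-- The simplex `[p₁, …, pₘ]`. -/
def simplex {m : ℕ} (p : Fin m → P) : AltChains P m :=
  mkAlt P m (Finsupp.single p 1)

theorem simplex_perm {m : ℕ} (p : Fin m → P) (σ : Equiv.Perm (Fin m)) :
    simplex (p ∘ σ) = (Equiv.Perm.sign σ : ℤ) • simplex p := by
  unfold simplex
  rw [← map_zsmul, ← sub_eq_zero, ← map_sub, Finsupp.smul_single, smul_eq_mul, mul_one]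
  exact (QuotientAddGroup.eq_zero_iff _).2 (AddSubgroup.subset_closure (Or.inl ⟨p, σ, rfl⟩))

theorem simplex_of_not_injective {m : ℕ} (p : Fin m → P) (h : ¬ Function.Injective p) :
    simplex p = 0 :=
  (QuotientAddGroup.eq_zero_iff _).2 (AddSubgroup.subset_closure (Or.inr ⟨p, h, rfl⟩))

/-- An alternating function on simplices defines a homomorphism on alternating chains. -/
def liftAlt {A : Type*} [AddCommGroup A] {m : ℕ} (φ : (Fin m → P) → A)
    (h₁ : ∀ p (σ : Equiv.Perm (Fin m)), φ (p ∘ σ) = (Equiv.Perm.sign σ : ℤ) • φ p)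
    (h₂ : ∀ p, ¬ Function.Injective p → φ p = 0) : AltChains P m →+ A :=
  QuotientAddGroup.lift (altRelations P m)
    (Finsupp.liftAddHom fun p => zmultiplesHom A (φ p)) (by
      unfold altRelations
      rw [AddSubgroup.closure_le]
      rintro x (⟨p, σ, rfl⟩ | ⟨p, h, rfl⟩)
      · rw [SetLike.mem_coe, AddMonoidHom.mem_ker, map_sub]
        simp [h₁]
      · simp [h₂ p h])

@[simp]
theorem liftAlt_simplex {A : Type*} [AddCommGroup A] {m : ℕ} (φ : (Fin m → P) → A) (h₁) (h₂)
    (p : Fin m → P) : liftAlt φ h₁ h₂ (simplex p) = φ p := by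
  change Finsupp.liftAddHom (fun p => zmultiplesHom A (φ p)) (Finsupp.single p 1) = φ p
  simp

theorem alt_hom_ext {A : Type*} [AddCommGroup A] {m : ℕ} {f g : AltChains P m →+ A}
    (h : ∀ p, f (simplex p) = g (simplex p)) : f = g := by
  apply QuotientAddGroup.addMonoidHom_ext
  apply Finsupp.addHom_ext'
  intro p
  apply AddMonoidHom.ext_int
  exact h p

/-- The permutation `ρ⁻¹ * π` fixes `0`, so it is a permutation `τ` of the other positions with the
same sign. Thus the signed face depends only on the omitted vertex. -/
theorem simplex_face_congr {m : ℕ} (p : Fin (m + 1) → P) (π ρ : Equiv.Perm (Fin (m + 1)))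
    (h : π 0 = ρ 0) :
    (Equiv.Perm.sign π : ℤ) • simplex (p ∘ π ∘ Fin.succ) =
      (Equiv.Perm.sign ρ : ℤ) • simplex (p ∘ ρ ∘ Fin.succ) := by
  obtain ⟨⟨q, τ⟩, hτ⟩ := Equiv.Perm.decomposeFin.symm.surjective (ρ⁻¹ * π)
  have hq : q = 0 := by
    have := congrArg (fun e : Equiv.Perm (Fin (m + 1)) => e 0) hτ
    simpa [h] using this
  subst hq
  have hπ : π = ρ * Equiv.Perm.decomposeFin.symm (0, τ) := by rw [hτ]; group
  have hs : p ∘ π ∘ Fin.succ = (p ∘ ρ ∘ Fin.succ) ∘ τ := by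
    funext j
    simp [hπ]
  rw [hs, simplex_perm, hπ, smul_smul]
  congr 1
  rw [Equiv.Perm.sign_mul, Equiv.Perm.decomposeFin.symm_sign]
  rcases Int.units_eq_one_or (Equiv.Perm.sign τ) with h | h <;> simp [h]

theorem simplex_face_eq {m : ℕ} (p : Fin (m + 1) → P) (i : Fin (m + 1)) :
    ((-1 : ℤ) ^ (i : ℕ)) • simplex (p ∘ i.succAbove) =
      (Equiv.Perm.sign i.cycleRange⁻¹ : ℤ) •
        simplex (p ∘ (i.cycleRange⁻¹ : Equiv.Perm _) ∘ Fin.succ) := by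
  rw [Equiv.Perm.sign_inv, Fin.sign_cycleRange]
  have : (i.cycleRange⁻¹ : Equiv.Perm (Fin (m + 1))) ∘ Fin.succ = i.succAbove := by
    funext j
    simp only [Function.comp_apply]
    rw [Equiv.Perm.inv_eq_iff_eq, Fin.cycleRange_succAbove]
  rw [this]
  simp

variable (P) in
/-- The boundary map of the complex of alternating chains. -/
def altBoundary (m : ℕ) : AltChains P (m + 1) →+ AltChains P m :=
  liftAlt (fun p => ∑ i : Fin (m + 1), ((-1 : ℤ) ^ (i : ℕ)) • simplex (p ∘ i.succAbove))
    (by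
      intro p σ
      rw [Finset.smul_sum, ← Equiv.sum_comp σ (fun i => (Equiv.Perm.sign σ : ℤ) •
        ((-1 : ℤ) ^ (i : ℕ)) • simplex (p ∘ i.succAbove))]
      refine Finset.sum_congr rfl fun i _ => ?_
      rw [simplex_face_eq, simplex_face_eq,
        ← simplex_face_congr p (σ * i.cycleRange⁻¹) ((σ i).cycleRange⁻¹)
        (by rw [Equiv.Perm.mul_apply, cycleRange_inv_zero, cycleRange_inv_zero]), smul_smul,
        Equiv.Perm.sign_mul]
      have hc : (p ∘ σ) ∘ (i.cycleRange⁻¹ : Equiv.Perm _) ∘ Fin.succ =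
        p ∘ (σ * i.cycleRange⁻¹ : Equiv.Perm _) ∘ Fin.succ := rfl
      rw [hc]
      congr 1
      rcases Int.units_eq_one_or (Equiv.Perm.sign σ) with h | h <;> simp [h])
    (by
      intro v hv
      rw [Function.not_injective_iff] at hv
      obtain ⟨p, q, hpq, hne⟩ := hv
      -- Every face other than those omitting `p` or `q` still has a repeated vertex. The two
      -- remaining faces differ by the transposition of `p` and `q`, so they cancel.
      rw [Finset.sum_eq_add p q hne]
      · rw [simplex_face_eq, simplex_face_eq,
          ← simplex_face_congr v (Equiv.swap p q * p.cycleRange⁻¹) (q.cycleRange⁻¹)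
          (by rw [Equiv.Perm.mul_apply, cycleRange_inv_zero, cycleRange_inv_zero]; simp),
          Equiv.Perm.sign_mul, Equiv.Perm.sign_swap hne]
        have hs : v ∘ Equiv.swap p q = v := by
          funext j
          simp only [Function.comp_apply]
          rw [Equiv.swap_apply_def]
          split_ifs with h1 h2
          · rw [h1, hpq]
          · rw [h2, hpq]
          · rfl
        have hc : v ∘ (Equiv.swap p q * p.cycleRange⁻¹ : Equiv.Perm _) ∘ Fin.succ =
            v ∘ (p.cycleRange⁻¹ : Equiv.Perm _) ∘ Fin.succ :=
          congrArg (· ∘ (p.cycleRange⁻¹ : Equiv.Perm _) ∘ Fin.succ) hs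
        rw [hc]
        simp
      · intro i _ hi
        rw [simplex_of_not_injective, smul_zero]
        obtain ⟨p', hp'⟩ := Fin.exists_succAbove_eq hi.1.symm
        obtain ⟨q', hq'⟩ := Fin.exists_succAbove_eq hi.2.symm
        intro hinj
        apply hne
        rw [← hp', ← hq']
        congr 1
        apply hinj
        simp [hp', hq', hpq]
      · simp
      · simp)

@[simp]
theorem altBoundary_simplex {m : ℕ} (p : Fin (m + 1) → P) :
    altBoundary P m (simplex p) =
      ∑ i : Fin (m + 1), ((-1 : ℤ) ^ (i : ℕ)) • simplex (p ∘ i.succAbove) :=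
  liftAlt_simplex _ _ _ p

/-- The cone `[p₁, …, pₘ] ↦ [o, p₁, …, pₘ]`, whose apex `o` may depend on the set of vertices
of the simplex. -/
def cone (o : Set P → P) (m : ℕ) : AltChains P m →+ AltChains P (m + 1) :=
  liftAlt (fun p => simplex (Fin.cons (o (Set.range p)) p))
    (by
      intro p σ
      -- The apex depends only on the vertex set, hence is unchanged by `σ`; `decomposeFin.symm (0,
      -- σ)` extends `σ` by fixing the apex and has the same sign.
      have h : (Fin.cons (o (Set.range (p ∘ σ))) (p ∘ σ) : Fin (m + 1) → P) =
          Fin.cons (o (Set.range p)) p ∘ Equiv.Perm.decomposeFin.symm (0, σ) := by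
        rw [σ.surjective.range_comp]
        funext j
        refine Fin.cases ?_ (fun j => ?_) j <;> simp
      rw [h, simplex_perm, Equiv.Perm.decomposeFin.symm_sign]
      simp)
    (by
      intro p hp
      refine simplex_of_not_injective _ fun h => hp ?_
      have := h.comp (Fin.succ_injective m)
      simpa [Function.comp_def] using this)

@[simp]
theorem cone_simplex (o : Set P → P) {m : ℕ} (p : Fin m → P) :
    cone o m (simplex p) = simplex (Fin.cons (o (Set.range p)) p) :=
  liftAlt_simplex _ _ _ p

theorem cons_comp_succAbove_succ {m : ℕ} (a : P) (p : Fin (m + 1) → P) (i : Fin (m + 1)) :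
    (Fin.cons a p : Fin (m + 2) → P) ∘ i.succ.succAbove = Fin.cons a (p ∘ i.succAbove) := by
  funext j
  refine Fin.cases ?_ (fun j => ?_) j <;> simp

theorem cons_comp_succAbove_zero {m : ℕ} (a : P) (p : Fin m → P) :
    (Fin.cons a p : Fin (m + 1) → P) ∘ (0 : Fin (m + 1)).succAbove = p := by
  funext j
  simp

/-- Omitting the apex gives back `p`; every other face of the cone is the cone over a face of `p`
with opposite sign. These cancel as soon as the cones over the faces use the same apex, which is
hypothesis `h`. -/
theorem altBoundary_cone_simplex (o : Set P → P) {m : ℕ} (p : Fin (m + 1) → P)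
    (h : ∀ i : Fin (m + 1), o (Set.range (p ∘ i.succAbove)) = o (Set.range p)) :
    altBoundary P (m + 1) (cone o (m + 1) (simplex p)) + cone o m (altBoundary P m (simplex p)) =
      simplex p := by
  rw [cone_simplex, altBoundary_simplex, altBoundary_simplex, Fin.sum_univ_succ, map_sum,
    cons_comp_succAbove_zero, add_assoc, ← Finset.sum_add_distrib]
  simp only [cons_comp_succAbove_succ, map_zsmul, cone_simplex, h, Fin.val_succ, pow_succ]
  simp

theorem altBoundary_cone_const (a : P) (m : ℕ) (x : AltChains P (m + 1)) :
    altBoundary P (m + 1) (cone (fun _ => a) (m + 1) x) +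
      cone (fun _ => a) m (altBoundary P m x) = x := by
  have : (altBoundary P (m + 1)).comp (cone (fun _ => a) (m + 1)) +
      (cone (fun _ => a) m).comp (altBoundary P m) = AddMonoidHom.id _ :=
    alt_hom_ext fun p => altBoundary_cone_simplex _ p fun _ => rfl
  exact DFunLike.congr_fun this x

/-- The bottom of the homotopy: the empty simplex has no boundary, so the term `cone ∘ ∂` is absent.
-/
theorem altBoundary_cone_const_zero (a : P) (x : AltChains P 0) :
    altBoundary P 0 (cone (fun _ => a) 0 x) = x := by
  have : (altBoundary P 0).comp (cone (fun _ => a) 0) = AddMonoidHom.id _ :=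
    alt_hom_ext fun p => by
      simp only [AddMonoidHom.comp_apply, cone_simplex, altBoundary_simplex, AddMonoidHom.id_apply,
        Fin.sum_univ_succ, cons_comp_succAbove_zero]
      simp
  exact DFunLike.congr_fun this x

/-- Each simplex is the cone `c` over its tail from its first vertex, and `∂c = 1 - c∂`. Hence `∂∂c
= ∂ - ∂c∂ = c∂∂`, which vanishes by induction; no double sum is needed. -/
theorem altBoundary_altBoundary (m : ℕ) (x : AltChains P (m + 2)) :
    altBoundary P m (altBoundary P (m + 1) x) = 0 := by
  induction m with
  | zero =>
    have : (altBoundary P 0).comp (altBoundary P 1) = 0 := alt_hom_ext fun p => by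
      have hp : simplex p = cone (fun _ => p 0) 1 (simplex (p ∘ Fin.succ)) := by
        rw [cone_simplex]; congr 1; exact (Fin.cons_self_tail p).symm
      have h := altBoundary_cone_const (p 0) 0 (simplex (p ∘ Fin.succ))
      rw [AddMonoidHom.comp_apply, hp, eq_sub_of_add_eq h, map_sub, altBoundary_cone_const_zero,
        sub_self]
      rfl
    exact DFunLike.congr_fun this x
  | succ m ih =>
    have : (altBoundary P (m + 1)).comp (altBoundary P (m + 2)) = 0 := alt_hom_ext fun p => by
      have hp : simplex p = cone (fun _ => p 0) (m + 2) (simplex (p ∘ Fin.succ)) := by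
        rw [cone_simplex]; congr 1; exact (Fin.cons_self_tail p).symm
      have h := altBoundary_cone_const (p 0) (m + 1) (simplex (p ∘ Fin.succ))
      have h' := altBoundary_cone_const (p 0) m (altBoundary P (m + 1) (simplex (p ∘ Fin.succ)))
      rw [ih, map_zero, add_zero] at h'
      rw [AddMonoidHom.comp_apply, hp, eq_sub_of_add_eq h, map_sub, h', sub_self]
      rfl
    exact DFunLike.congr_fun this x

end AltChains

open scoped LinearAlgebra.Projectivization DirectSum

/-! ### Sharblies as a quotient of alternating chains on the projective space -/

section Sharblies

variable {K : Type u} [Field K] {V : Type u} [AddCommGroup V] [Module K V]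

/-- A representative of a point of the projective space. -/
def repVec (p : ℙ K V) : NonzeroVec V := ⟨p.rep, p.rep_nonzero⟩

/-- The point of the projective space defined by a nonzero vector. -/
def toPoint (K : Type u) [Field K] {V : Type u} [AddCommGroup V] [Module K V]
    (a : NonzeroVec V) : ℙ K V :=
  Projectivization.mk K a.1 a.2

theorem toPoint_repVec (p : ℙ K V) : toPoint K (repVec p) = p := p.mk_rep

theorem exists_repVec_toPoint (a : NonzeroVec V) :
    ∃ c : Kˣ, (repVec (toPoint K a) : V) = (c : K) • (a : V) := by
  obtain ⟨c, hc⟩ := Projectivization.exists_smul_eq_mk_rep K a.1 a.2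
  exact ⟨c, hc.symm⟩

theorem toPoint_eq_of_smul {a b : NonzeroVec V} (h : ∃ c : Kˣ, (b : V) = (c : K) • (a : V)) :
    toPoint K b = toPoint K a := by
  obtain ⟨c, hc⟩ := h
  exact (Projectivization.mk_eq_mk_iff K _ _ _ _).2 ⟨c, hc.symm⟩

theorem symbol_repVec_toPoint {m : ℕ} (v : Fin m → NonzeroVec V) :
    symbol K (repVec ∘ toPoint K ∘ v) = symbol K v :=
  symbol_scale _ _ fun i => exists_repVec_toPoint (v i)

/-- The linear span of a set of points. -/
def pointSpan (s : Set (ℙ K V)) : Submodule K V :=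
  Submodule.span K (Projectivization.rep '' s)

theorem rep_mem_pointSpan {s : Set (ℙ K V)} {p : ℙ K V} (h : p ∈ s) : p.rep ∈ pointSpan s :=
  Submodule.subset_span ⟨p, h, rfl⟩

theorem pointSpan_mono {s t : Set (ℙ K V)} (h : s ⊆ t) : pointSpan s ≤ pointSpan t :=
  Submodule.span_mono (Set.image_mono h)

theorem pointSpan_range {m : ℕ} (p : Fin m → ℙ K V) :
    pointSpan (Set.range p) = Submodule.span K (Set.range fun i => (repVec (p i) : V)) := by
  unfold pointSpan
  rw [← Set.range_comp]
  rfl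

theorem pointSpan_range_toPoint {m : ℕ} (v : Fin m → NonzeroVec V) :
    pointSpan (Set.range (toPoint K ∘ v)) = Submodule.span K (Set.range fun i => (v i : V)) := by
  rw [pointSpan_range, Submodule.span_range_eq_iSup, Submodule.span_range_eq_iSup]
  refine iSup_congr fun i => ?_
  obtain ⟨c, hc⟩ := exists_repVec_toPoint (K := K) (v i)
  rw [Function.comp_apply, hc, Submodule.span_singleton_smul_eq c.isUnit]

theorem pointSpan_range_cons {m : ℕ} (a : ℙ K V) (p : Fin m → ℙ K V)
    (h : a.rep ∈ pointSpan (Set.range p)) :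
    pointSpan (Set.range (Fin.cons a p : Fin (m + 1) → ℙ K V)) = pointSpan (Set.range p) := by
  rw [Fin.range_cons]
  unfold pointSpan at h ⊢
  rw [Set.image_insert_eq, Submodule.span_insert_eq_span h]

/-! ### Sharblies as chains modulo non-spanning chains -/

variable (K V) in
/-- The subgroup of the alternating chains generated by the simplices which do not span `V`. -/
def nonspanning (m : ℕ) : AddSubgroup (AltChains (ℙ K V) m) :=
  AddSubgroup.closure {x | ∃ p : Fin m → ℙ K V, pointSpan (Set.range p) ≠ ⊤ ∧ x = simplex p}

theorem simplex_mem_nonspanning {m : ℕ} {p : Fin m → ℙ K V} (h : pointSpan (Set.range p) ≠ ⊤) :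
    simplex p ∈ nonspanning K V m :=
  AddSubgroup.subset_closure ⟨p, h, rfl⟩

variable (K V) in
/-- The projection of the alternating chains to the sharblies. -/
def altToSymbols (m : ℕ) : AltChains (ℙ K V) m →+ Symbols K V m :=
  liftAlt (fun p => symbol K (repVec ∘ p)) (fun p σ => symbol_perm (repVec ∘ p) σ)
    (fun _ h => symbol_not_injective _ fun h' => h h'.of_comp)

@[simp]
theorem altToSymbols_simplex {m : ℕ} (p : Fin m → ℙ K V) :
    altToSymbols K V m (simplex p) = symbol K (repVec ∘ p) :=
  liftAlt_simplex _ _ _ p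

theorem altToSymbols_surjective (m : ℕ) : Function.Surjective (altToSymbols K V m) := by
  rw [← AddMonoidHom.range_eq_top, ← QuotientAddGroup.ker_mk' (altToSymbols K V m).range]
  have : QuotientAddGroup.mk' (altToSymbols K V m).range = 0 := symbols_hom_ext fun v =>
    (QuotientAddGroup.eq_zero_iff _).2
      ⟨simplex (toPoint K ∘ v), by rw [altToSymbols_simplex, symbol_repVec_toPoint]⟩
  rw [this, AddMonoidHom.ker_zero]

theorem boundary_altToSymbols (m : ℕ) (x : AltChains (ℙ K V) (m + 1)) :
    boundary K V m (altToSymbols K V (m + 1) x) = altToSymbols K V m (altBoundary _ m x) := by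
  have : (boundary K V m).comp (altToSymbols K V (m + 1)) =
      (altToSymbols K V m).comp (altBoundary _ m) := alt_hom_ext fun p => by
    simp only [AddMonoidHom.comp_apply, altToSymbols_simplex, boundary_symbol, altBoundary_simplex,
      map_sum, map_zsmul]
    rfl
  exact DFunLike.congr_fun this x

theorem altToSymbols_of_mem {m : ℕ} {x : AltChains (ℙ K V) m} (h : x ∈ nonspanning K V m) :
    altToSymbols K V m x = 0 := by
  suffices nonspanning K V m ≤ (altToSymbols K V m).ker from this h
  unfold nonspanning
  rw [AddSubgroup.closure_le]
  rintro _ ⟨p, hp, rfl⟩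
  rw [SetLike.mem_coe, AddMonoidHom.mem_ker, altToSymbols_simplex]
  exact symbol_not_span _ (by rwa [pointSpan_range] at hp)

/-- Sending a vector to its point respects all the sharbly relations modulo non-spanning simplices.
The resulting map `f` to the quotient, composed with the projection, is the quotient map, so the
kernel is no larger than `nonspanning`. -/
theorem mem_nonspanning_of_altToSymbols {m : ℕ} {x : AltChains (ℙ K V) m}
    (h : altToSymbols K V m x = 0) : x ∈ nonspanning K V m := by
  let f : Symbols K V m →+ AltChains (ℙ K V) m ⧸ nonspanning K V m :=
    liftSymbols (K := K) (fun v => QuotientAddGroup.mk' _ (simplex (toPoint K ∘ v)))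
      (fun v σ => by rw [← map_zsmul, ← simplex_perm]; rfl)
      (fun v h => by
        rw [simplex_of_not_injective _ fun h' => h h'.of_comp, map_zero])
      (fun v w h => by
        congr 2
        funext i
        exact toPoint_eq_of_smul (h i))
      (fun v h => (QuotientAddGroup.eq_zero_iff _).2
        (simplex_mem_nonspanning (by rwa [pointSpan_range_toPoint])))
  have hf : f.comp (altToSymbols K V m) = QuotientAddGroup.mk' _ := alt_hom_ext fun p => by
    rw [AddMonoidHom.comp_apply, altToSymbols_simplex]
    refine (liftSymbols_symbol _ _ _ _ _ _).trans ?_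
    congr 2
    funext i
    exact toPoint_repVec (p i)
  have hx := DFunLike.congr_fun hf x
  rw [AddMonoidHom.comp_apply, h, map_zero] at hx
  exact (QuotientAddGroup.eq_zero_iff _).1 hx.symm

theorem boundary_boundary (m : ℕ) (x : Symbols K V (m + 2)) :
    boundary K V m (boundary K V (m + 1) x) = 0 := by
  obtain ⟨y, rfl⟩ := altToSymbols_surjective _ x
  rw [boundary_altToSymbols, boundary_altToSymbols, altBoundary_altBoundary, map_zero]

/-! ### Contracting the non-spanning chains -/

open Classical in
/-- A point in a given linear subspace, chosen arbitrarily, if the subspace is nonzero. -/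
def somePoint [Nonempty (ℙ K V)] (S : Submodule K V) : ℙ K V :=
  if h : ∃ p : ℙ K V, p.rep ∈ S then h.choose else Classical.arbitrary _

theorem somePoint_rep_mem [Nonempty (ℙ K V)] {S : Submodule K V} {p : ℙ K V} (h : p.rep ∈ S) :
    (somePoint S).rep ∈ S := by
  have h' : ∃ p : ℙ K V, p.rep ∈ S := ⟨p, h⟩
  unfold somePoint
  rw [dif_pos h']
  exact h'.choose_spec

variable (K V) in
/-- The cone whose apex lies in the span of the simplex and depends only on this span. -/
def spanCone [Nonempty (ℙ K V)] (m : ℕ) : AltChains (ℙ K V) m →+ AltChains (ℙ K V) (m + 1) :=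
  cone (fun s => somePoint (pointSpan s)) m

/-- An apex inside the span does not enlarge it. At least one vertex is needed for the span to
contain a point. -/
theorem spanCone_mem_nonspanning [Nonempty (ℙ K V)] {m : ℕ} {x : AltChains (ℙ K V) (m + 1)}
    (h : x ∈ nonspanning K V (m + 1)) : spanCone K V (m + 1) x ∈ nonspanning K V (m + 2) := by
  suffices nonspanning K V (m + 1) ≤ (nonspanning K V (m + 2)).comap (spanCone K V (m + 1)) from
    this h
  conv_lhs => unfold nonspanning
  rw [AddSubgroup.closure_le]
  rintro _ ⟨p, hp, rfl⟩
  rw [SetLike.mem_coe, AddSubgroup.mem_comap, spanCone, cone_simplex]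
  apply simplex_mem_nonspanning
  rwa [pointSpan_range_cons]
  exact somePoint_rep_mem (rep_mem_pointSpan (Set.mem_range_self 0))

theorem linearIndependent_rep_pair {p q : ℙ K V} (h : p ≠ q) :
    LinearIndependent K ![p.rep, q.rep] := by
  rw [LinearIndependent.pair_iff' p.rep_nonzero]
  intro c hc
  apply h
  rw [← p.mk_rep, ← q.mk_rep]
  exact ((Projectivization.mk_eq_mk_iff' K _ _ _ _).2 ⟨c, hc⟩).symm

theorem two_le_finrank_pointSpan [FiniteDimensional K V] {s : Set (ℙ K V)} {p q : ℙ K V}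
    (hp : p ∈ s) (hq : q ∈ s) (h : p ≠ q) : 2 ≤ Module.finrank K (pointSpan s) := by
  have h1 := finrank_span_eq_card (linearIndependent_rep_pair h)
  refine (h1.trans (Fintype.card_fin 2)).symm.le.trans ?_
  apply Submodule.finrank_mono
  rw [Submodule.span_le]
  rintro _ ⟨i, rfl⟩
  fin_cases i
  · exact rep_mem_pointSpan hp
  · exact rep_mem_pointSpan hq

/-- A facet keeps two distinct points, so its span has dimension at least 2, while a proper subspace
of `V` has dimension at most 2. -/
theorem pointSpan_face (hV : Module.finrank K V = 3) {m : ℕ} {p : Fin (m + 3) → ℙ K V}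
    (hp : Function.Injective p) (hs : pointSpan (Set.range p) ≠ ⊤) (i : Fin (m + 3)) :
    pointSpan (Set.range (p ∘ i.succAbove)) = pointSpan (Set.range p) := by
  have : FiniteDimensional K V := Module.finite_of_finrank_pos (by rw [hV]; decide)
  apply Submodule.eq_of_le_of_finrank_le (pointSpan_mono (Set.range_comp_subset_range _ _))
  have h1 := Submodule.finrank_lt hs
  have h2 : 2 ≤ Module.finrank K (pointSpan (Set.range (p ∘ i.succAbove))) :=
    two_le_finrank_pointSpan (Set.mem_range_self 0) (Set.mem_range_self 1) fun h => by
      have := i.succAbove_right_injective (hp h)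
      simp at this
  omega

/-- By `pointSpan_face` a simplex with distinct vertices and its facets share the same span, hence
the same apex. With only two vertices the facets are single points and this argument breaks down. -/
theorem altBoundary_spanCone [Nonempty (ℙ K V)] (hV : Module.finrank K V = 3) {m : ℕ}
    {x : AltChains (ℙ K V) (m + 3)} (h : x ∈ nonspanning K V (m + 3)) :
    altBoundary _ (m + 3) (spanCone K V (m + 3) x) +
      spanCone K V (m + 2) (altBoundary _ (m + 2) x) = x := by
  suffices nonspanning K V (m + 3) ≤ ((altBoundary _ (m + 3)).comp (spanCone K V (m + 3)) +
      (spanCone K V (m + 2)).comp (altBoundary _ (m + 2))).eqLocus (AddMonoidHom.id _) from this h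
  unfold nonspanning
  rw [AddSubgroup.closure_le]
  rintro _ ⟨p, hp, rfl⟩
  by_cases hi : Function.Injective p
  · exact altBoundary_cone_simplex _ p fun i => by rw [pointSpan_face hV hi hp]
  · rw [simplex_of_not_injective p hi]
    exact zero_mem _

theorem nonempty_points (hV : Module.finrank K V = 3) : Nonempty (ℙ K V) := by
  have : Nontrivial V := Module.nontrivial_of_finrank_pos (R := K) (by rw [hV]; decide)
  infer_instance

/-- A chain whose boundary bounds a chain of non-spanning simplices represents a boundary in the
sharbly complex. -/
theorem altToSymbols_mem_range [Nonempty (ℙ K V)] {m : ℕ} {x y : AltChains (ℙ K V) (m + 1)}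
    (hy : y ∈ nonspanning K V (m + 1)) (h : altBoundary _ m x = altBoundary _ m y) :
    altToSymbols K V (m + 1) x ∈ (boundary K V (m + 1)).range := by
  -- The cycle `x - y` bounds its cone, and `y` vanishes as a sharbly.
  have h1 := altBoundary_cone_const (Classical.arbitrary (ℙ K V)) m (x - y)
  rw [map_sub (altBoundary _ m), h, sub_self, map_zero, add_zero] at h1
  refine ⟨altToSymbols K V (m + 2) (cone (fun _ => Classical.arbitrary (ℙ K V)) (m + 1) (x - y)),
    ?_⟩
  rw [boundary_altToSymbols, h1, map_sub, altToSymbols_of_mem hy, sub_zero]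

/-- For a lift `y` of a cycle, `∂y` is a non-spanning cycle with at least three vertices. Its
`spanCone` is a non-spanning chain with the same boundary as `y`, so `altToSymbols_mem_range`
applies. -/
theorem exact_boundary (hV : Module.finrank K V = 3) {m : ℕ} (hm : 3 ≤ m) :
    Function.Exact (boundary K V (m + 1)) (boundary K V m) := by
  obtain ⟨m, rfl⟩ := Nat.exists_eq_add_of_le' hm
  have := nonempty_points hV
  intro x
  constructor
  · intro hx
    obtain ⟨y, rfl⟩ := altToSymbols_surjective _ x
    rw [boundary_altToSymbols] at hx
    have hN := mem_nonspanning_of_altToSymbols hx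
    have h1 := altBoundary_spanCone hV hN
    rw [altBoundary_altBoundary, map_zero, add_zero] at h1
    exact altToSymbols_mem_range (spanCone_mem_nonspanning hN) h1.symm
  · rintro ⟨y, rfl⟩
    exact boundary_boundary _ y

end Sharblies

/-! ### Exactness at the spliced terms -/

section Splice

variable {K : Type u} [Field K] {V : Type u} [AddCommGroup V] [Module K V]

theorem span_pair_inclVec {H : Submodule K V} (v : Fin 2 → NonzeroVec H) :
    Submodule.span K ({(inclVec (v 0)).1, (inclVec (v 1)).1} : Set V) =
      (Submodule.span K (Set.range fun i => (v i : H))).map H.subtype := by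
  rw [Submodule.map_span, ← Set.range_comp]
  congr 1
  ext x
  simp [Fin.exists_fin_two, inclVec, eq_comm]

/-- The plane may be any one containing both vectors: if they are proportional, both sides are zero.
-/
theorem edge_inclVec (H : Plane K V) (v : Fin 2 → NonzeroVec H.1) :
    edge K (inclVec (v 0)) (inclVec (v 1)) = ofPlane H (stSymbol K v) := by
  have hs := span_pair_inclVec v
  have hf : FiniteDimensional K H.1 := Module.finite_of_finrank_pos (by rw [H.2]; decide)
  by_cases h : Submodule.span K (Set.range fun i => (v i : H.1)) = ⊤
  · rw [h, Submodule.map_subtype_top] at hs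
    exact edge_eq H v hs.symm
  · rw [stSymbol, symbol_not_span v h, map_zero, map_zero]
    apply edge_of_finrank_ne
    rw [hs, Submodule.finrank_map_subtype_eq]
    have h1 := Submodule.finrank_lt h
    rw [H.2] at h1
    exact h1.ne

theorem stSymbol_triangle {W : Type u} [AddCommGroup W] [Module K W] (v : Fin 3 → NonzeroVec W) :
    stSymbol K ![v 1, v 2] - stSymbol K ![v 0, v 2] + stSymbol K ![v 0, v 1] = 0 := by
  have h : mkSteinberg K W 2 (boundary K W 2 (symbol K v)) = 0 :=
    (QuotientAddGroup.eq_zero_iff _).2 ⟨_, rfl⟩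
  rw [boundary_symbol, map_sum] at h
  have h0 : v ∘ (0 : Fin 3).succAbove = ![v 1, v 2] := by funext i; fin_cases i <;> rfl
  have h1 : v ∘ (1 : Fin 3).succAbove = ![v 0, v 2] := by funext i; fin_cases i <;> rfl
  have h2 : v ∘ (2 : Fin 3).succAbove = ![v 0, v 1] := by funext i; fin_cases i <;> rfl
  rw [Fin.sum_univ_three, h0, h1, h2] at h
  rw [← h]
  simp only [stSymbol, map_zsmul]
  simp [sub_eq_add_neg]

/-- A proper subspace lies in a coatom, and a line spanned by a vector outside the coatom is a
complement to it. -/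
theorem exists_plane_ge (hV : Module.finrank K V = 3) {S : Submodule K V} (h : S ≠ ⊤) :
    ∃ H : Plane K V, S ≤ H.1 := by
  have : FiniteDimensional K V := Module.finite_of_finrank_pos (by rw [hV]; decide)
  obtain ⟨H, hH, hS⟩ := (eq_top_or_exists_le_coatom S).resolve_left h
  obtain ⟨x, -, hx⟩ := SetLike.exists_of_lt hH.lt_top
  have hc := Submodule.isCompl_span_singleton_of_isCoatom_of_notMem hH hx
  have h1 := Submodule.finrank_add_eq_of_isCompl hc
  rw [finrank_span_singleton (by rintro rfl; exact hx (zero_mem _)), hV] at h1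
  exact ⟨⟨H, by omega⟩, hS⟩

/-- Three vectors that do not span `V` lie in a common plane `H`, where the identity is the defining
relation of `St₂(H)`. This lets `triangle_eq` drop the case distinction in `triangle`. -/
theorem edge_triangle (hV : Module.finrank K V = 3) (v : Fin 3 → NonzeroVec V)
    (h : Submodule.span K (Set.range fun i => (v i : V)) ≠ ⊤) :
    edge K (v 0) (v 1) + edge K (v 1) (v 2) + edge K (v 2) (v 0) = 0 := by
  obtain ⟨H, hH⟩ := exists_plane_ge hV h
  let w : Fin 3 → NonzeroVec H.1 := fun i =>
    ⟨⟨(v i).1, hH (Submodule.subset_span ⟨i, rfl⟩)⟩, fun h => (v i).2 (congrArg Subtype.val h)⟩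
  have he (i j : Fin 3) : edge K (v i) (v j) = ofPlane H (stSymbol K ![w i, w j]) :=
    edge_inclVec H ![w i, w j]
  have hz := congrArg (ofPlane H) (stSymbol_triangle w)
  rw [edge_swap (v 0) (v 2), he, he, he, ← sub_eq_add_neg]
  rw [map_add, map_sub, map_zero] at hz
  rw [← hz]
  abel

theorem triangle_eq (hV : Module.finrank K V = 3) (v : Fin 3 → NonzeroVec V) :
    triangle K v = edge K (v 0) (v 1) + edge K (v 1) (v 2) + edge K (v 2) (v 0) := by
  unfold triangle
  split_ifs with h
  · rfl
  · exact (edge_triangle hV v h).symm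

theorem planeBoundary_edge (a b : NonzeroVec V) :
    planeBoundary K V (edge K a b) = point K b - point K a := by
  by_cases h : Module.finrank K (Submodule.span K ({a.1, b.1} : Set V)) = 2
  · let H : Plane K V := ⟨_, h⟩
    let v : Fin 2 → NonzeroVec H.1 :=
      ![⟨⟨a.1, Submodule.subset_span (by simp)⟩, fun h => a.2 (congrArg Subtype.val h)⟩,
        ⟨⟨b.1, Submodule.subset_span (by simp)⟩, fun h => b.2 (congrArg Subtype.val h)⟩]
    exact (congrArg _ (edge_inclVec H v)).trans (planeBoundary_apply H v)
  · rw [edge_of_finrank_ne a b h, map_zero, eq_comm, sub_eq_zero]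
    have hli : ¬ LinearIndependent K ![a.1, b.1] := fun hli => h (by
      have := finrank_span_eq_card hli
      rwa [Matrix.range_cons_cons_empty, Fintype.card_fin] at this)
    rw [LinearIndependent.pair_iff' a.2] at hli
    push Not at hli
    obtain ⟨c, hc⟩ := hli
    have hc0 : c ≠ 0 := by
      rintro rfl
      exact b.2 (by rw [← hc, zero_smul])
    exact point_scale _ _ ⟨Units.mk0 c hc0, hc.symm⟩

variable (K) in
/-- The homomorphism `(p) ↦ {o, p}`. -/
def edgesFrom (o : NonzeroVec V) : Points K V →+ PlaneSteinberg K V :=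
  Finsupp.liftAddHom fun p => zmultiplesHom _ (edge K o (repVec p))

theorem edgesFrom_point (o a : NonzeroVec V) : edgesFrom K o (point K a) = edge K o a := by
  have h : edgesFrom K o (point K a) = edge K o (repVec (toPoint K a)) := by
    change Finsupp.liftAddHom (fun p => zmultiplesHom _ (edge K o (repVec p)))
      (Finsupp.single (toPoint K a) 1) = _
    simp
  rw [h]
  exact edge_scale _ _ _ _ ⟨1, by simp⟩ (exists_repVec_toPoint a)

/-! ### Exactness at `ℤ`, `X₀` and `X₁` -/

theorem augmentation_surjective (hV : Module.finrank K V = 3) :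
    Function.Surjective (augmentation K V) := by
  obtain ⟨p⟩ := nonempty_points hV
  intro n
  exact ⟨n • point K (repVec p), by rw [map_zsmul, augmentation_point]; simp⟩

theorem exact_planeBoundary_augmentation (hV : Module.finrank K V = 3) :
    Function.Exact (planeBoundary K V) (augmentation K V) := by
  obtain ⟨p⟩ := nonempty_points hV
  -- `planes_hom_ext` needs a target in `Type u`, so `ℤ` is lifted to that universe.
  have h1 : (AddEquiv.ulift.{0, u}.symm.toAddMonoidHom.comp (augmentation K V)).comp
      (planeBoundary K V) = 0 := planes_hom_ext fun H v => by
    rw [AddMonoidHom.comp_apply, AddMonoidHom.comp_apply, planeBoundary_apply, map_sub,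
      augmentation_point, augmentation_point, sub_self, map_zero]
    rfl
  -- Contracting homotopy: `∂₁{o, a} = (a) - (o)` for the base point `o`, so `∂₁` of the edges from
  -- `o` is `x - ε(x)(o)`.
  have h2 : (planeBoundary K V).comp (edgesFrom K (repVec p)) =
      AddMonoidHom.id _ - (zmultiplesHom _ (point K (repVec p))).comp (augmentation K V) :=
    points_hom_ext fun a => by
      simp [edgesFrom_point, planeBoundary_edge, augmentation_point]
  intro x
  constructor
  · intro hx
    have := DFunLike.congr_fun h2 x
    refine ⟨edgesFrom K (repVec p) x, this.trans ?_⟩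
    simp [hx]
  · rintro ⟨y, rfl⟩
    exact congrArg ULift.down (DFunLike.congr_fun h1 y)

theorem planeBoundary_triangleBoundary (x : Symbols K V 3) :
    planeBoundary K V (triangleBoundary K V x) = 0 := by
  have : (planeBoundary K V).comp (triangleBoundary K V) = 0 := symbols_hom_ext fun v => by
    rw [AddMonoidHom.comp_apply, triangleBoundary_symbol, triangle]
    split_ifs
    · simp [planeBoundary_edge]
    · exact map_zero _
  exact DFunLike.congr_fun this x

theorem exact_triangleBoundary_planeBoundary (hV : Module.finrank K V = 3) :
    Function.Exact (triangleBoundary K V) (planeBoundary K V) := by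
  obtain ⟨p⟩ := nonempty_points hV
  let o : NonzeroVec V := repVec p
  let q := QuotientAddGroup.mk' (triangleBoundary K V).range
  -- Modulo the image of `∂₂`, replacing `{a, b}` by `{o, b} - {o, a}` changes nothing; the
  -- difference is `∂₂[o, a, b]`.
  have h : q.comp ((edgesFrom K o).comp (planeBoundary K V)) = q := planes_hom_ext fun H v => by
    rw [AddMonoidHom.comp_apply, AddMonoidHom.comp_apply, planeBoundary_apply, map_sub,
      edgesFrom_point, edgesFrom_point, ← edge_inclVec, eq_comm, ← sub_eq_zero, ← map_sub]
    refine (QuotientAddGroup.eq_zero_iff _).2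
      ⟨symbol K ![o, inclVec (v 0), inclVec (v 1)], ?_⟩
    rw [triangleBoundary_symbol, triangle_eq hV]
    change edge K o (inclVec (v 0)) + edge K (inclVec (v 0)) (inclVec (v 1)) +
      edge K (inclVec (v 1)) o = _
    rw [edge_swap o]
    abel
  intro x
  constructor
  · intro hx
    have h1 := DFunLike.congr_fun h x
    rw [AddMonoidHom.comp_apply, AddMonoidHom.comp_apply, hx, map_zero, map_zero] at h1
    exact (QuotientAddGroup.eq_zero_iff _).1 h1.symm
  · rintro ⟨y, rfl⟩
    exact planeBoundary_triangleBoundary y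

/-! ### Exactness at `X₂` -/

variable (K V) in
/-- The homomorphism `[p, q] ↦ {p, q}`. -/
def altToPlanes : AltChains (ℙ K V) 2 →+ PlaneSteinberg K V :=
  liftAlt (fun p => edge K (repVec (p 0)) (repVec (p 1)))
    (by
      intro p σ
      have hσ : σ = 1 ∨ σ = Equiv.swap 0 1 := by
        revert σ
        decide
      rcases hσ with rfl | rfl
      · simp
      · simp [edge_swap (repVec (p 0)) (repVec (p 1))])
    (by
      intro p hp
      have : p 0 = p 1 := by
        by_contra hne
        apply hp
        intro i j hij
        fin_cases i <;> fin_cases j <;> simp_all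
      rw [this, edge_self])

@[simp]
theorem altToPlanes_simplex (p : Fin 2 → ℙ K V) :
    altToPlanes K V (simplex p) = edge K (repVec (p 0)) (repVec (p 1)) :=
  liftAlt_simplex _ _ _ p

/-- Thanks to `triangle_eq` this covers non-spanning simplices as well, so `∂₂` can be studied
through the boundary of chains. -/
theorem triangleBoundary_altToSymbols (hV : Module.finrank K V = 3) (x : AltChains (ℙ K V) 3) :
    triangleBoundary K V (altToSymbols K V 3 x) = altToPlanes K V (altBoundary _ 2 x) := by
  have : (triangleBoundary K V).comp (altToSymbols K V 3) =
      (altToPlanes K V).comp (altBoundary _ 2) := alt_hom_ext fun p => by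
    simp only [AddMonoidHom.comp_apply, altToSymbols_simplex, triangleBoundary_symbol,
      altBoundary_simplex, triangle_eq hV, map_sum, map_zsmul, altToPlanes_simplex]
    rw [Fin.sum_univ_three]
    simp [Fin.succAbove, edge_swap (repVec (p 0)) (repVec (p 2))]
    abel
  exact DFunLike.congr_fun this x

theorem inclVec_span_ne_top (hV : Module.finrank K V = 3) (H : Plane K V) {m : ℕ}
    (v : Fin m → NonzeroVec H.1) :
    Submodule.span K (Set.range fun i => (inclVec (v i) : V)) ≠ ⊤ := by
  intro h
  have hH : H.1 = ⊤ := by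
    rw [eq_top_iff, ← h, Submodule.span_le]
    rintro _ ⟨i, rfl⟩
    exact (v i).1.2
  have h2 := H.2
  rw [hH, finrank_top, hV] at h2
  omega

theorem toPoint_inclVec_eq {H : Submodule K V} {v w : NonzeroVec H} (h : toPoint K v = toPoint K w) :
    toPoint K (inclVec v) = toPoint K (inclVec w) := by
  obtain ⟨c, hc⟩ := (Projectivization.mk_eq_mk_iff K _ _ _ _).1 h
  exact toPoint_eq_of_smul ⟨c, by simp [inclVec, ← hc, Units.smul_def]⟩

theorem toPoint_eq_of_span_ne_top {W : Type u} [AddCommGroup W] [Module K W]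
    (hW : Module.finrank K W = 2) (v : Fin 2 → NonzeroVec W)
    (h : Submodule.span K (Set.range fun i => (v i : W)) ≠ ⊤) :
    toPoint K (v 0) = toPoint K (v 1) := by
  have : FiniteDimensional K W := Module.finite_of_finrank_pos (by rw [hW]; decide)
  by_contra hne
  have h1 := two_le_finrank_pointSpan (Set.mem_range_self (f := toPoint K ∘ v) 0)
    (Set.mem_range_self 1) hne
  rw [pointSpan_range_toPoint] at h1
  have h2 := Submodule.finrank_lt h
  omega

/-- The kernel of `[p, q] ↦ {p, q}` consists of boundaries of non-spanning chains. -/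
theorem exists_nonspanning_of_altToPlanes (hV : Module.finrank K V = 3)
    {x : AltChains (ℙ K V) 2} (h : altToPlanes K V x = 0) :
    ∃ y ∈ nonspanning K V 3, altBoundary _ 2 y = x := by
  let q := QuotientAddGroup.mk' ((nonspanning K V 3).map (altBoundary (ℙ K V) 2))
  -- An inverse of `[p, q] ↦ {p, q}` with values modulo boundaries of non-spanning triangles is
  -- built plane by plane.
  let φ (H : Plane K V) : Symbols K H.1 2 →+ _ :=
    liftSymbols (K := K) (fun v => q (simplex (toPoint K ∘ inclVec ∘ v)))
      (fun v σ => by rw [← map_zsmul, ← simplex_perm]; rfl)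
      (fun v h => by
        rw [simplex_of_not_injective, map_zero]
        rw [← Function.comp_assoc]
        exact fun h' => h h'.of_comp)
      (fun v w h => by
        congr 2
        funext i
        exact toPoint_inclVec_eq (toPoint_eq_of_smul (h i)))
      (fun v h => by
        rw [simplex_of_not_injective, map_zero]
        intro h'
        have := @h' 0 1 (toPoint_inclVec_eq (toPoint_eq_of_span_ne_top H.2 v h))
        simp at this)
  have hφ (H : Plane K V) : (φ H).comp (boundary K H.1 2) = 0 := symbols_hom_ext fun v => by
    rw [AddMonoidHom.comp_apply, boundary_symbol, map_sum]
    simp only [map_zsmul, φ, liftSymbols_symbol]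
    simp only [← map_zsmul]
    rw [← map_sum]
    -- The Steinberg relation in `H` goes to the boundary of a triangle inside `H`, which is
    -- non-spanning.
    refine (QuotientAddGroup.eq_zero_iff _).2 ⟨simplex (toPoint K ∘ inclVec ∘ v), ?_, ?_⟩
    · apply simplex_mem_nonspanning
      rw [pointSpan_range_toPoint]
      exact inclVec_span_ne_top hV H v
    · exact altBoundary_simplex _
  let θ : PlaneSteinberg K V →+ _ := liftPlanes fun H => liftSteinberg (φ H) (hφ H)
  have hθ : θ.comp (altToPlanes K V) = q := alt_hom_ext fun p => by
    by_cases hp : p 0 = p 1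
    · rw [simplex_of_not_injective p fun h => by simpa using h hp, map_zero, map_zero]
    let v (i : Fin 2) : NonzeroVec V := repVec (p i)
    have hs : Module.finrank K (Submodule.span K ({(v 0).1, (v 1).1} : Set V)) = 2 := by
      have := finrank_span_eq_card (linearIndependent_rep_pair hp)
      rwa [Matrix.range_cons_cons_empty, Fintype.card_fin] at this
    let H : Plane K V := ⟨_, hs⟩
    let w : Fin 2 → NonzeroVec H.1 :=
      ![⟨⟨(v 0).1, Submodule.subset_span (by simp)⟩, fun h => (v 0).2 (congrArg Subtype.val h)⟩,
        ⟨⟨(v 1).1, Submodule.subset_span (by simp)⟩, fun h => (v 1).2 (congrArg Subtype.val h)⟩]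
    have he : altToPlanes K V (simplex p) = ofPlane H (stSymbol K w) :=
      (altToPlanes_simplex p).trans (edge_inclVec H w)
    rw [AddMonoidHom.comp_apply, he, liftPlanes_ofPlane, liftSteinberg_stSymbol,
      liftSymbols_symbol]
    congr 2
    funext i
    fin_cases i
    · exact toPoint_repVec (p 0)
    · exact toPoint_repVec (p 1)
  have h1 := DFunLike.congr_fun hθ x
  rw [AddMonoidHom.comp_apply, h, map_zero] at h1
  exact (QuotientAddGroup.eq_zero_iff _).1 h1.symm

/-- If `∂₂` kills the class of `y`, then `∂y` is the boundary of a non-spanning chain by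
`exists_nonspanning_of_altToPlanes`, and correcting `y` by that chain gives a cycle of the
contractible complex. -/
theorem exact_boundary_triangleBoundary (hV : Module.finrank K V = 3) :
    Function.Exact (boundary K V 3) (triangleBoundary K V) := by
  have := nonempty_points hV
  intro x
  constructor
  · intro hx
    obtain ⟨y, rfl⟩ := altToSymbols_surjective _ x
    rw [triangleBoundary_altToSymbols hV] at hx
    obtain ⟨z, hz, hzy⟩ := exists_nonspanning_of_altToPlanes hV hx
    exact altToSymbols_mem_range hz hzy.symm
  · rintro ⟨y, rfl⟩
    obtain ⟨z, rfl⟩ := altToSymbols_surjective _ y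
    rw [boundary_altToSymbols, triangleBoundary_altToSymbols hV, altBoundary_altBoundary, map_zero]

end Splice

end Spliced

end

theorem mainTheorem5 (K : Type*) [Field K] [Infinite K] :
    Function.Surjective (Spliced.ε K) ∧
    Function.Exact (Spliced.d K 0).hom (Spliced.ε K) ∧
    ∀ i : ℕ, Function.Exact (Spliced.d K (i + 1)).hom (Spliced.d K i).hom := by
  have hV : Module.finrank K (Spliced.Row K) = 3 := Module.finrank_fin_fun K
  refine ⟨Spliced.augmentation_surjective hV, Spliced.exact_planeBoundary_augmentation hV, ?_⟩
  -- The cases are exactness at `X₁`, at `X₂`, and at `X_{k+3}`, whose symbols have `3 + k + 1`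
  -- arguments.
  rintro (_ | _ | k)
  · exact Spliced.exact_triangleBoundary_planeBoundary hV
  · exact Spliced.exact_boundary_triangleBoundary hV
  · exact Spliced.exact_boundary hV (Nat.le_add_right 3 k)
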